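/- **Lemma (stability of the non-conservative ALE-SUPG scheme with the implicit Euler method).** *Setting.* Let $d\in\{2,3\}$, $T>0$, $N\ge 1$, $\Delta t=T/N$, $t^n=n\Delta t$, $\epsilon>0$. Let $\hat{\mathcal T}$ be a finite conforming triangulation into $d$-simplices of a closed polyhedral reference domain $\overline{\hat\Omega}$, and for $0\le n\le N$ let $\mathcal A_{t^n}:\overline{\hat\Omega}\to\mathbb R^d$ be continuous and affine on every cell. For $t\in[t^n,t^{n+1}]$, $n<N$, put $$\mathcal A_{h,\Delta t}(t)=\tfrac{t-t^n}{\Delta t}\mathcal A_{t^{n+1}}+\tfrac{t^{n+1}-t}{\Delta t}\mathcal A_{t^n},$$ assume that this map is injective on $\overline{\hat\Omega}$ for every such $t$, and let $\Omega_t$ be the interior of its image; $\mathcal T_{t^n}$ is the image mesh of $\Omega_{t^n}$, with cells $K$ of diameter $h_K$. The mesh velocity on $\Omega_t$, $t\in(t^n,t^{n+1}]$, is $$\mathbf w_h(t)=\frac{\mathcal A_{t^{n+1}}-\mathcal A_{t^n}}{\Delta t}\circ\mathcal A_{h,\Delta t}(t)^{-1},\qquad \mathbf w_h^{n+1}=\mathbf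 w_h(t^{n+1}).$$ Write $\mathcal A_{t^m,t^n}=\mathcal A_{t^n}\circ\mathcal A_{t^m}^{-1}$, and let $J_{\mathcal A_{t^n,t^{n+1}}}$ be the Jacobian determinant of $\mathcal A_{t^n,t^{n+1}}$. Let $V_h^n$ be the space of $v\in C(\overline{\Omega_{t^n}})$ with $v=0$ on $\partial\Omega_{t^n}$ and $v|_K$ a polynomial of degree at most $k$ for every $K\in\mathcal T_{t^n}$. For $1\le n\le N$, let $\mathbf b=\mathbf b(t^n,\cdot)$ be Lipschitz on $\Omega_{t^n}$, $c=c(t^n,\cdot)\in L^\infty(\Omega_{t^n})$ and $f^n=f(t^n,\cdot)\in L^2(\Omega_{t^n})$, and let $\delta_K\ge 0$ for $K\in\mathcal T_{t^n}$. *Scheme.* Let $u_h^n\in V_h^n$ $(0\le n\le N)$ satisfy, for all $0\le n<N$ and all $v\in V_h^{n+1}$, $$\Big(\frac{u_h^{n+1}-u_h^n\circ\mathcal A_{t^{n+1},t^n}}{\Delta t},v\Big)_{\Omega_{t^{n+1}}}+a^{n+1}_{SUPG}(u_h^{n+1},v)-\int_{\Omega_{t^{n+1}}}\mathbf w_h^{n+1}\cdot\nabla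 u_h^{n+1}\,v\,dx=\int_{\Omega_{t^{n+1}}}f^{n+1}v\,dx+\sum_{K\in\mathcal T_{t^{n+1}}}\delta_K\int_K f^{n+1}(\mathbf b-\mathbf w_h^{n+1})\cdot\nabla v\,dx,$$ where, for $n\ge1$, $$a^{n}_{SUPG}(u,v)=\epsilon(\nabla u,\nabla v)_{\Omega_{t^n}}+(\mathbf b\cdot\nabla u,v)_{\Omega_{t^n}}+(cu,v)_{\Omega_{t^n}}+\sum_{K\in\mathcal T_{t^n}}\delta_K\big(-\epsilon\Delta u+(\mathbf b-\mathbf w_h^n)\cdot\nabla u+cu,\ (\mathbf b-\mathbf w_h^n)\cdot\nabla v\big)_K .$$ *Assumptions.* Let $\mu>0$ and let $c_{inv}>0$ be a constant in the inverse inequality $\|\Delta v\|_{L^2(K)}\le c_{inv}h_K^{-1}\|\nabla v\|_{L^2(K)}$ $(v\in V_h^n,\ K\in\mathcal T_{t^n},\ 1\le n\le N)$. Assume that for $1\le n\le N$ $$c-\tfrac12\nabla\cdot\mathbf b\ge\mu\ \text{ a.e. in }\Omega_{t^n},\qquad \delta_K\le\frac{\mu}{2\|c\|_{L^\infty(K)}^2},\quad\delta_K\le\frac{h_K^2}{2\epsilon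 c_{inv}^2},\quad\delta_K\le\frac{\Delta t}{4}\qquad(K\in\mathcal T_{t^n})$$ (the first bound on $\delta_K$ being void if $c=0$ on $K$). Put $$|||v|||^2=\epsilon\|\nabla v\|_{L^2(\Omega_{t^n})}^2+\sum_{K\in\mathcal T_{t^n}}\delta_K\|(\mathbf b-\mathbf w_h^n)\cdot\nabla v\|_{L^2(K)}^2+\mu\|v\|_{L^2(\Omega_{t^n})}^2\qquad(v\in V_h^n,\ n\ge1),$$ $$\alpha_1^n=\|\nabla\cdot\mathbf w_h^n\|_{L^\infty(\Omega_{t^n})}\ (1\le n\le N),\qquad \alpha_2^n=\sup_{t\in(t^n,t^{n+1})}\|J_{\mathcal A_{t^n,t^{n+1}}}\,\nabla\cdot\mathbf w_h(t)\|_{L^\infty(\Omega_t)}\ (0\le n<N),\qquad\alpha_2^N=0,$$ where $J_{\mathcal A_{t^n,t^{n+1}}}$ is regarded as a function on $\Omega_t$ through the ALE mapping. *Conclusion.* Let $0\le n<N$ and $\Delta t(\alpha_1^i+\alpha_2^i)<1$ for $1\le i\le n+1$. Then $$\|u_h^{n+1}\|^2_{L^2(\Omega_{t^{n+1}})}+\frac{\Delta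 t}{2}\sum_{i=1}^{n+1}|||u_h^i|||^2\le\Big[(1+\Delta t\,\alpha_2^0)\|u_h^0\|^2_{L^2(\Omega_{t^0})}+\Delta t\sum_{i=1}^{n+1}\Big(\frac2\mu+\frac{\Delta t}{2}\Big)\|f^i\|^2_{L^2(\Omega_{t^i})}\Big]\exp\Big(\Delta t\sum_{i=1}^{n+1}\frac{\alpha_1^i+\alpha_2^i}{1-\Delta t(\alpha_1^i+\alpha_2^i)}\Big).$$ -/

import Mathlib

open MeasureTheory Set
open scoped ENNReal

noncomputable section

namespace ALESUPG

/-- The Euclidean space `ℝ^d`. -/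
abbrev E (d : ℕ) : Type := EuclideanSpace ℝ (Fin d)

/-- A finite conforming triangulation into nondegenerate `d`-simplices: a finite simplicial complex
in `ℝ^d`, each of whose faces is a face of a `d`-simplex of the complex. -/
structure Triangulation (d : ℕ) extends Geometry.SimplicialComplex ℝ (E d) where
  finite_faces : faces.Finite
  pure_faces : ∀ s ∈ faces, ∃ σ ∈ faces, s ⊆ σ ∧ σ.card = d + 1

/-- The cells (`d`-simplices) of a triangulation, each given by its set of vertices. -/
def Triangulation.cells {d : ℕ} (M : Triangulation d) : Finset (Finset (E d)) :=
  (M.finite_faces.subset (Set.sep_subset M.faces fun σ => σ.card = d + 1)).toFinset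

/-- The closed polyhedron covered by the triangulation. -/
abbrev Triangulation.region {d : ℕ} (M : Triangulation d) : Set (E d) :=
  M.toSimplicialComplex.space

/-- Membership in the vector-valued Lagrange space of degree one: continuous on the triangulated
region and affine on every cell. -/
def Triangulation.IsP1Map {d : ℕ} (M : Triangulation d) (φ : E d → E d) : Prop :=
  ContinuousOn φ M.region ∧
    ∀ σ ∈ M.cells, ∃ g : E d →ᵃ[ℝ] E d, EqOn φ g (convexHull ℝ (σ : Set (E d)))

/-- The divergence `∑ i, ∂F_i/∂x_i`. -/
def divergence {d : ℕ} (F : E d → E d) (x : E d) : ℝ :=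
  ∑ i : Fin d, (fderiv ℝ F x (EuclideanSpace.single i 1)) i

/-- The `L^∞` norm on a set. -/
def linfty {d : ℕ} (s : Set (E d)) (g : E d → ℝ) : ℝ≥0∞ :=
  eLpNorm g ∞ (volume.restrict s)

/-- The squared `L²` norm on a set. -/
def l2sq {d : ℕ} (s : Set (E d)) (g : E d → ℝ) : ℝ :=
  ∫ x in s, g x ^ 2

/-- The data of the fully discrete scheme; the assumptions on them are hypotheses of the theorem. -/
structure Scheme (d : ℕ) where
  /-- the triangulation of the reference domain -/
  mesh : Triangulation d
  /-- the polynomial degree of the finite element space -/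
  k : ℕ
  /-- the end time -/
  T : ℝ
  /-- the number of time steps -/
  N : ℕ
  /-- the semidiscrete ALE mapping `A t Y` -/
  A : ℝ → E d → E d
  /-- the diffusivity -/
  eps : ℝ
  /-- the convective velocity `b t x` -/
  b : ℝ → E d → E d
  /-- the reaction coefficient `c t x` -/
  c : ℝ → E d → ℝ
  /-- the source term `f t x` -/
  f : ℝ → E d → ℝ
  /-- the stabilization parameter at a time level on the image of a reference cell -/
  δ : ℕ → Finset (E d) → ℝ

namespace Scheme

variable {d : ℕ} (S : Scheme d)

/-- The time step `Δt = T / N`. -/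
def dt : ℝ := S.T / S.N

/-- The time levels `t^n = n Δt`. -/
def time (n : ℕ) : ℝ := n * S.dt

/-- The discrete ALE mapping at a time `t ∈ [t^n, t^{n+1}]`: linear interpolation in time. -/
def interp (n : ℕ) (t : ℝ) (Y : E d) : E d :=
  ((t - S.time n) / S.dt) • S.A (S.time (n + 1)) Y +
    ((S.time (n + 1) - t) / S.dt) • S.A (S.time n) Y

/-- The inverse of the discrete ALE mapping at a time `t ∈ [t^n, t^{n+1}]`. -/
def interpInv (n : ℕ) (t : ℝ) : E d → E d :=
  Function.invFunOn (S.interp n t) S.mesh.region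

/-- The domain `Ω_t` for `t ∈ [t^n, t^{n+1}]`. -/
def domAt (n : ℕ) (t : ℝ) : Set (E d) := interior (S.interp n t '' S.mesh.region)

/-- The closure of the domain `Ω_{t^n}`. -/
def closedDom (n : ℕ) : Set (E d) := S.A (S.time n) '' S.mesh.region

/-- The domain `Ω_{t^n}`. -/
def dom (n : ℕ) : Set (E d) := interior (S.closedDom n)

/-- The cell `K` of the mesh at time `t^n` that corresponds to the reference cell `σ`. -/
def cell (n : ℕ) (σ : Finset (E d)) : Set (E d) :=
  S.A (S.time n) '' convexHull ℝ (σ : Set (E d))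

/-- The ALE mapping `A_{t^m, t^n} = A_{t^n} ∘ A_{t^m}⁻¹` between two time levels. -/
def transfer (m n : ℕ) (x : E d) : E d :=
  S.A (S.time n) (Function.invFunOn (S.A (S.time m)) S.mesh.region x)

/-- The Jacobian determinant of `A_{t^n, t^{n+1}}`, a function on `Ω_{t^n}`. -/
def jac (n : ℕ) (x : E d) : ℝ := (fderiv ℝ (S.transfer n (n + 1)) x).det

/-- The mesh velocity `(A_{t^{n+1}}(Y) - A_{t^n}(Y)) / Δt` of the step from `t^n` to `t^{n+1}`,
as a function of `x ∈ Ω_t`, for `t ∈ [t^n, t^{n+1}]`. -/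
def meshVel (n : ℕ) (t : ℝ) (x : E d) : E d :=
  (S.dt)⁻¹ • (S.A (S.time (n + 1)) (S.interpInv n t x) - S.A (S.time n) (S.interpInv n t x))

/-- The mesh velocity `w_h^n` on `Ω_{t^n}`, `n ≥ 1`, that of the step from `t^{n-1}` to `t^n`. -/
def w (n : ℕ) : E d → E d := S.meshVel (n - 1) (S.time n)

/-- The relative convective velocity `b - w_h^n` at time `t^n`, `n ≥ 1`. -/
def relVel (n : ℕ) (x : E d) : E d := S.b (S.time n) x - S.w n x

/-- The finite element space `V_h` on `Ω_{t^n}`: continuous on the closed domain, zero on the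
boundary, a polynomial of degree at most `k` on every cell. -/
def InVh (n : ℕ) (v : E d → ℝ) : Prop :=
  ContinuousOn v (S.closedDom n) ∧
    (∀ x ∈ frontier (S.closedDom n), v x = 0) ∧
    ∀ σ ∈ S.mesh.cells, ∃ p : MvPolynomial (Fin d) ℝ, p.totalDegree ≤ S.k ∧
      ∀ x ∈ S.cell n σ, v x = MvPolynomial.eval (fun i => x i) p

/-- The bilinear form `a_SUPG^n`, `n ≥ 1`. -/
def aSUPG (n : ℕ) (u v : E d → ℝ) : ℝ :=
  S.eps * (∫ x in S.dom n, inner ℝ (gradient u x) (gradient v x)) +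
    (∫ x in S.dom n, inner ℝ (S.b (S.time n) x) (gradient u x) * v x) +
    (∫ x in S.dom n, S.c (S.time n) x * u x * v x) +
    ∑ σ ∈ S.mesh.cells, S.δ n σ * ∫ x in S.cell n σ,
      (-S.eps * Laplacian.laplacian u x + inner ℝ (S.relVel n x) (gradient u x) +
        S.c (S.time n) x * u x) * inner ℝ (S.relVel n x) (gradient v x)

/-- `u n ∈ V_h`, `n = 0, …, N`, is a solution of the non-conservative ALE-SUPG scheme with the
implicit Euler method. -/
def IsSolution (u : ℕ → E d → ℝ) : Prop :=
  (∀ n ≤ S.N, S.InVh n (u n)) ∧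
    ∀ n < S.N, ∀ v : E d → ℝ, S.InVh (n + 1) v →
      (∫ x in S.dom (n + 1), (u (n + 1) x - u n (S.transfer (n + 1) n x)) / S.dt * v x) +
          S.aSUPG (n + 1) (u (n + 1)) v -
          (∫ x in S.dom (n + 1), inner ℝ (S.w (n + 1) x) (gradient (u (n + 1)) x) * v x) =
        (∫ x in S.dom (n + 1), S.f (S.time (n + 1)) x * v x) +
          ∑ σ ∈ S.mesh.cells, S.δ (n + 1) σ * ∫ x in S.cell (n + 1) σ,
            S.f (S.time (n + 1)) x * inner ℝ (S.relVel (n + 1) x) (gradient v x)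

/-- The squared mesh-dependent norm `|||v|||²` at time `t^n`, `n ≥ 1`. -/
def supgNormSq (μ : ℝ) (n : ℕ) (v : E d → ℝ) : ℝ :=
  S.eps * (∫ x in S.dom n, ‖gradient v x‖ ^ 2) +
    (∑ σ ∈ S.mesh.cells,
      S.δ n σ * l2sq (S.cell n σ) (fun x => inner ℝ (S.relVel n x) (gradient v x))) +
    μ * l2sq (S.dom n) v

/-- `C` is a constant in the inverse inequality `‖Δ v_h‖_{0,K} ≤ C h_K⁻¹ |v_h|_{1,K}` on the finite
element spaces at the times `t^1, …, t^N`. -/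
def IsInverseConst (C : ℝ) : Prop :=
  0 < C ∧ ∀ n ∈ Finset.Icc 1 S.N, ∀ σ ∈ S.mesh.cells, ∀ v : E d → ℝ, S.InVh n v →
    Real.sqrt (l2sq (S.cell n σ) (Laplacian.laplacian v)) ≤
      C * (Metric.diam (S.cell n σ))⁻¹ * Real.sqrt (∫ x in S.cell n σ, ‖gradient v x‖ ^ 2)

/-- `α₁^n`, `n ≥ 1`: the `L^∞` norm of `∇ · w_h^n` on `Ω_{t^n}`. -/
def alpha1 (n : ℕ) : ℝ := (linfty (S.dom n) (divergence (S.w n))).toReal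

/-- `α₂^n`: the supremum over `t ∈ (t^n, t^{n+1})` of the `L^∞(Ω_t)` norm of `∇ · w_h` multiplied by
the Jacobian of `A_{t^n, t^{n+1}}`, carried to `Ω_t` by the ALE mapping. No step starts at `t^N`,
and `α₂^N = 0`. -/
def alpha2 (n : ℕ) : ℝ :=
  if n < S.N then
    (⨆ t ∈ Ioo (S.time n) (S.time (n + 1)),
      linfty (S.domAt n t) (fun x =>
        S.jac n (S.A (S.time n) (S.interpInv n t x)) * divergence (S.meshVel n t) x)).toReal
  else 0

end Scheme

end ALESUPG

end

open Filter Topology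
open scoped NNReal

namespace ALESUPG

/-! The scheme is tested with its own solution. The implicit difference quotient bounds half the
increment of the squared norm, the old solution being carried to the new domain. Integration by
parts (`Admissible.integral_relVel_eq_zero`) replaces the convection term for b - w by -1/2 times
the integral of (∇·b - ∇·w)u². The coercivity of c - ∇·b/2 therefore survives up to α₁/2 times the
squared norm. The stabilization terms are split by Young's inequality: the three bounds on δ move
the Laplacian part into the diffusion, the reaction part into the μ-term, and the source part into a
multiple of Δt. Multiplying by 2Δt gives `IsSolution.energy_step`.

The motion of the domain enters through the norm of the transferred old solution. On each cell the
transfer is affine, so its Jacobian J is a constant, the quotient of the determinants of the linear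
parts `l1` and `l0`. During the step the linear part runs along the segment from `l0` to `l1`, and
injectivity keeps its determinant away from zero. Hence J > 0, and the mean value theorem for the
logarithm of the determinant gives log J = Δt ∇·w at some intermediate time. Since J - 1 ≤ J log J,
it follows that J ≤ 1 + Δt α₂ (`StepPieces.det_div_det_le`), and summing over cells gives
`InVh.l2sq_transfer_le`.

A discrete Gronwall inequality combines the steps. The factor 1 + Δt α₂ of the following step is
kept with the current norm, so that α₁ and α₂ are charged at the same level and only α₂ at level 0
remains outside the exponential. -/

/-! ### Convex cells: integrals over their union and boundedness of piecewise continuous functions.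
-/

/-- A finite family of compact convex sets with pairwise disjoint interiors. -/
structure IsCellFamily {ι : Type*} {d : ℕ} (s : Finset ι) (K : ι → Set (E d)) : Prop where
  isCompact : ∀ i ∈ s, IsCompact (K i)
  convex : ∀ i ∈ s, Convex ℝ (K i)
  disjoint : (s : Set ι).PairwiseDisjoint fun i => interior (K i)

/-- A function that agrees with a continuous function on the interior of every cell. -/
def PiecewiseContinuous {ι F : Type*} [TopologicalSpace F] {d : ℕ} (s : Finset ι)
    (K : ι → Set (E d)) (g : E d → F) : Prop :=
  ∀ i ∈ s, ∃ G : E d → F, Continuous G ∧ EqOn g G (interior (K i))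

namespace IsCellFamily

variable {ι : Type*} {d : ℕ} {s : Finset ι} {K : ι → Set (E d)}

theorem interior_ae_eq (h : IsCellFamily s K) {i : ι} (hi : i ∈ s) :
    (interior (K i) : Set (E d)) =ᵐ[volume] K i :=
  interior_ae_eq_of_null_frontier ((h.convex i hi).addHaar_frontier volume)

theorem isCompact_biUnion (h : IsCellFamily s K) : IsCompact (⋃ i ∈ s, K i) :=
  s.isCompact_biUnion h.isCompact

theorem biUnion_interior_ae_eq (h : IsCellFamily s K) :
    (⋃ i ∈ s, interior (K i) : Set (E d)) =ᵐ[volume] ⋃ i ∈ s, K i :=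
  Filter.EventuallyEq.countable_bUnion s.countable_toSet fun _ hi => h.interior_ae_eq hi

theorem biUnion_interior_subset :
    (⋃ i ∈ s, interior (K i)) ⊆ interior (⋃ i ∈ s, K i) :=
  iUnion₂_subset fun _ hi => interior_mono (subset_biUnion_of_mem (u := K) hi)

/-- The interior of the union may also contain points of shared faces, but these lie on frontiers of
convex sets and form a null set. -/
theorem interior_biUnion_ae_eq (h : IsCellFamily s K) :
    (interior (⋃ i ∈ s, K i) : Set (E d)) =ᵐ[volume] ⋃ i ∈ s, interior (K i) := by
  refine EventuallyLE.antisymm ?_ (LE.le.eventuallyLE biUnion_interior_subset)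
  exact (LE.le.eventuallyLE interior_subset).trans h.biUnion_interior_ae_eq.symm.le

theorem interior_biUnion_ae_eq_biUnion (h : IsCellFamily s K) :
    (interior (⋃ i ∈ s, K i) : Set (E d)) =ᵐ[volume] ⋃ i ∈ s, K i :=
  h.interior_biUnion_ae_eq.trans h.biUnion_interior_ae_eq

theorem ae_mem_interior (h : IsCellFamily s K) :
    ∀ᵐ x ∂(volume.restrict (interior (⋃ i ∈ s, K i))), ∃ i ∈ s, x ∈ interior (K i) := by
  rw [Measure.restrict_congr_set h.interior_biUnion_ae_eq]
  filter_upwards [ae_restrict_mem (Finset.measurableSet_biUnion s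
    fun i _ => isOpen_interior.measurableSet)] with x hx
  simpa using hx

theorem restrict_cell_le (h : IsCellFamily s K) {i : ι} (hi : i ∈ s) :
    volume.restrict (K i) ≤ volume.restrict (interior (⋃ i ∈ s, K i)) := by
  rw [← Measure.restrict_congr_set (h.interior_ae_eq hi)]
  exact Measure.restrict_mono (interior_mono (subset_biUnion_of_mem (u := K) hi)) le_rfl

theorem setIntegral_eq_sum (h : IsCellFamily s K) {g : E d → ℝ}
    (hg : IntegrableOn g (interior (⋃ i ∈ s, K i))) :
    ∫ x in interior (⋃ i ∈ s, K i), g x = ∑ i ∈ s, ∫ x in K i, g x := by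
  rw [setIntegral_congr_set h.interior_biUnion_ae_eq, integral_biUnion_finset s
    (fun i _ => isOpen_interior.measurableSet) h.disjoint
    (fun i hi => hg.mono_set (interior_mono (subset_biUnion_of_mem (u := K) hi)))]
  exact Finset.sum_congr rfl fun i hi => setIntegral_congr_set (h.interior_ae_eq hi)

theorem isFiniteMeasure_restrict (h : IsCellFamily s K) :
    IsFiniteMeasure (volume.restrict (interior (⋃ i ∈ s, K i))) :=
  _root_.MeasureTheory.isFiniteMeasure_restrict.2
    ((measure_mono interior_subset).trans_lt h.isCompact_biUnion.measure_lt_top).ne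

end IsCellFamily

/-- Each continuous representative is bounded on its compact cell, and the open cells exhaust the
domain up to a null set. Values on the faces, where gradients and Laplacians of finite element
functions carry no information, play no role. -/
theorem PiecewiseContinuous.memLp_top {ι F : Type*} [NormedAddCommGroup F] {d : ℕ} {s : Finset ι}
    {K : ι → Set (E d)} (h : IsCellFamily s K) {g : E d → F} (hg : PiecewiseContinuous s K g) :
    MemLp g ∞ (volume.restrict (interior (⋃ i ∈ s, K i))) := by
  have := h.isFiniteMeasure_restrict
  choose! G hG hgG using hg
  have hb : ∀ i ∈ s, ∃ C, ∀ x ∈ K i, ‖G i x‖ ≤ C := fun i hi =>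
    (h.isCompact i hi).exists_bound_of_continuousOn (hG i hi).continuousOn
  choose! C hC using hb
  refine MemLp.of_bound ?_ (∑ i ∈ s, |C i|) ?_
  · rw [Measure.restrict_congr_set h.interior_biUnion_ae_eq, ← Finset.set_biUnion_coe,
      biUnion_eq_iUnion, aestronglyMeasurable_iUnion_iff]
    rintro ⟨i, hi⟩
    refine ((hG i hi).aestronglyMeasurable).congr ?_
    filter_upwards [ae_restrict_mem isOpen_interior.measurableSet] with x hx
    exact (hgG i hi hx).symm
  · filter_upwards [h.ae_mem_interior] with x ⟨i, hi, hx⟩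
    rw [hgG i hi hx]
    exact ((hC i hi x (interior_subset hx)).trans (le_abs_self _)).trans
      (Finset.single_le_sum (f := fun i => |C i|) (fun j _ => abs_nonneg _) hi)

/-! ### Lipschitz extension by zero and integration by parts. -/

/-- A function that is Lipschitz on each of finitely many compact sets and zero on the frontier of the union extends by zero to a Lipschitz function. -/
theorem exists_lipschitzWith_indicator {ι : Type*} {d : ℕ} {s : Finset ι} {K : ι → Set (E d)}
    (hK : ∀ i ∈ s, IsCompact (K i)) {v : E d → ℝ}
    (hv0 : ∀ x ∈ frontier (⋃ i ∈ s, K i), v x = 0)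
    (hL : ∀ i ∈ s, ∃ C : ℝ≥0, LipschitzOnWith C v (K i)) :
    ∃ C : ℝ≥0, LipschitzWith C ((⋃ i ∈ s, K i).indicator v) := by
  choose! C hC using hL
  have hv : ContinuousOn v (⋃ i ∈ s, K i) := by
    rw [← Finset.set_biUnion_coe, biUnion_eq_iUnion]
    exact (locallyFinite_of_finite _).continuousOn_iUnion (fun i => (hK i i.2).isClosed)
      fun i => (hC i i.2).continuousOn
  set D := ⋃ i ∈ s, K i with hD
  have hDc : IsClosed D := (s.isCompact_biUnion hK).isClosed
  have hcont : Continuous (D.indicator v) := continuous_indicator hv0 (by rwa [hDc.closure_eq])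
  refine ⟨∑ i ∈ s, C i, LipschitzWith.of_le_add_mul _ fun y x => ?_⟩
  set L : ℝ := ((∑ i ∈ s, C i : ℝ≥0) : ℝ) with hL
  -- The function is followed along the segment from x to y. A mean value inequality suffices that
  -- asks, at each t, only for small right slopes at points z arbitrarily close to t; this copes
  -- with a segment that changes cells infinitely often.
  let γ : ℝ → E d := fun t => x + t • (y - x)
  have hγ : Continuous γ := by fun_prop
  have hdist : ∀ t z, t ≤ z → dist (γ z) (γ t) = (z - t) * dist y x := fun t z htz => by
    simp only [γ, dist_eq_norm]
    rw [show x + z • (y - x) - (x + t • (y - x)) = (z - t) • (y - x) by module, norm_smul,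
      Real.norm_of_nonneg (sub_nonneg.2 htz)]
  have key := image_le_of_liminf_slope_right_le_deriv_boundary
    (f := fun t => D.indicator v (γ t)) (a := 0) (b := 1)
    (B := fun t => D.indicator v (γ 0) + t * (L * dist y x)) (B' := fun _ => L * dist y x)
    (hcont.comp hγ).continuousOn (by simp) (by fun_prop)
    (fun t _ => by
      simpa using (((hasDerivAt_id t).mul_const (L * dist y x)).const_add
        (D.indicator v (γ 0))).hasDerivWithinAt) ?_ (right_mem_Icc.2 zero_le_one)
  · simpa [γ] using key
  intro t _ r hr
  have hr0 : 0 < r := lt_of_le_of_lt (by positivity) hr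
  by_cases hfr : ∃ᶠ z in 𝓝[>] t, γ z ∈ D
  -- There are finitely many cells, so one of them is visited arbitrarily close to t. Being closed
  -- it contains γ t too, and its own Lipschitz constant bounds those slopes.
  · have : ∃ i ∈ s, ∃ᶠ z in 𝓝[>] t, γ z ∈ K i := by
      by_contra! hcon
      refine hfr ?_
      have : ∀ᶠ z in 𝓝[>] t, ∀ i ∈ s, γ z ∉ K i :=
        (Filter.eventually_all_finset s).2 fun i hi => by simpa using hcon i hi
      filter_upwards [this] with z hz
      simpa [hD] using hz
    obtain ⟨i, hi, hfi⟩ := this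
    have hti : γ t ∈ K i := by
      have hcl : IsClosed (γ ⁻¹' K i) := (hK i hi).isClosed.preimage hγ
      have := (hfi.filter_mono nhdsWithin_le_nhds)
      exact hcl.closure_subset (mem_closure_iff_frequently.2 this)
    refine (hfi.and_eventually self_mem_nhdsWithin).mono fun z ⟨hz, htz⟩ => ?_
    have htz' : t < z := htz
    have hsub : K i ⊆ D := subset_biUnion_of_mem (u := K) hi
    rw [slope_def_field, indicator_of_mem (hsub hz), indicator_of_mem (hsub hti)]
    refine lt_of_le_of_lt ?_ hr
    rw [div_le_iff₀ (sub_pos.2 htz')]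
    have h1 := (hC i hi).dist_le_mul _ hz _ hti
    rw [hdist t z htz'.le, Real.dist_eq] at h1
    have h2 : (C i : ℝ) ≤ L := by
      exact_mod_cast Finset.single_le_sum (f := C) (fun _ _ => zero_le) hi
    have h3 : (C i : ℝ) * ((z - t) * dist y x) ≤ L * ((z - t) * dist y x) :=
      mul_le_mul_of_nonneg_right h2 (mul_nonneg (sub_pos.2 htz').le dist_nonneg)
    linarith [le_abs_self (v (γ z) - v (γ t))]
  -- The segment is outside the union just after t, so the extension vanishes there and, by
  -- continuity, at t.
  · rw [Filter.not_frequently] at hfr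
    have hzero : (fun z => D.indicator v (γ z)) =ᶠ[𝓝[>] t] fun _ => 0 :=
      hfr.mono fun z hz => indicator_of_notMem hz _
    have ht0 : D.indicator v (γ t) = 0 := by
      have h1 : Tendsto (fun z => D.indicator v (γ z)) (𝓝[>] t) (𝓝 (D.indicator v (γ t))) :=
        ((hcont.comp hγ).tendsto t).mono_left nhdsWithin_le_nhds
      exact tendsto_nhds_unique h1 (tendsto_const_nhds.congr' hzero.symm)
    refine (hzero.mono fun z hz => ?_).frequently
    simp only at hz
    rw [slope_def_field, hz, ht0]
    simpa using hr0

/-- This is integration by parts against the constant 1, whose derivative vanishes. -/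
theorem integral_lineDeriv_eq_zero {d : ℕ} {g : E d → ℝ} {C : ℝ≥0} (hg : LipschitzWith C g)
    (hs : HasCompactSupport g) (v : E d) : ∫ x, lineDeriv ℝ g x v = 0 := by
  have := LipschitzWith.integral_lineDeriv_mul_eq (μ := volume)
    (LipschitzWith.const (1 : ℝ) : LipschitzWith 0 fun _ : E d => (1 : ℝ)) hg hs (-v)
  simpa [lineDeriv] using this.symm

/-- Compactness supplies the bounds on the factors that make a product of Lipschitz functions
Lipschitz. -/
theorem LipschitzOnWith.exists_mul_of_isCompact {α : Type*} [PseudoMetricSpace α] {s : Set α}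
    (hs : IsCompact s) {f g : α → ℝ} (hf : ∃ C : ℝ≥0, LipschitzOnWith C f s)
    (hg : ∃ C : ℝ≥0, LipschitzOnWith C g s) :
    ∃ C : ℝ≥0, LipschitzOnWith C (fun x => f x * g x) s := by
  obtain ⟨A, hA⟩ := hf
  obtain ⟨B, hB⟩ := hg
  obtain ⟨M, hM⟩ := hs.exists_bound_of_continuousOn hA.continuousOn
  obtain ⟨N, hN⟩ := hs.exists_bound_of_continuousOn hB.continuousOn
  refine ⟨M.toNNReal * B + N.toNNReal * A, LipschitzOnWith.of_dist_le_mul fun x hx y hy => ?_⟩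
  have h1 := hA.dist_le_mul x hx y hy
  have h2 := hB.dist_le_mul x hx y hy
  have hM0 : |f x| ≤ M := hM x hx
  have hN0 : |g y| ≤ N := hN y hy
  rw [Real.dist_eq] at h1 h2 ⊢
  have : f x * g x - f y * g y = f x * (g x - g y) + g y * (f x - f y) := by ring
  push_cast
  rw [Real.coe_toNNReal M ((abs_nonneg _).trans hM0), Real.coe_toNNReal N ((abs_nonneg _).trans hN0),
    this]
  refine (abs_add_le _ _).trans ?_
  rw [abs_mul, abs_mul]
  have h3 : |f x| * |g x - g y| ≤ M * (B * dist x y) := by gcongr; exact (abs_nonneg _).trans hM0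
  have h4 : |g y| * |f x - f y| ≤ N * (A * dist x y) := by gcongr; exact (abs_nonneg _).trans hN0
  linarith

theorem divergence_eq_sum_fderiv_apply {d : ℕ} {F : E d → E d} {x : E d}
    (hF : DifferentiableAt ℝ F x) :
    divergence F x =
      ∑ j, fderiv ℝ (fun y => F y j) x (EuclideanSpace.single j 1) := by
  refine Finset.sum_congr rfl fun j _ => ?_
  have := ((EuclideanSpace.proj (𝕜 := ℝ) j).hasFDerivAt.comp x hF.hasFDerivAt).fderiv
  rw [show (fun y => F y j) = (EuclideanSpace.proj (𝕜 := ℝ) j) ∘ F from rfl, this]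
  simp

theorem inner_gradient_eq_sum {d : ℕ} (v : E d → ℝ) (x z : E d) :
    inner ℝ z (gradient v x) = ∑ j, z j * fderiv ℝ v x (EuclideanSpace.single j 1) := by
  rw [real_inner_comm, gradient, InnerProductSpace.toDual_symm_apply]
  conv_lhs => rw [← (EuclideanSpace.basisFun (Fin d) ℝ).sum_repr z]
  simp

/-- Integration by parts: the integral of `div (v² F)` vanishes. -/
theorem integral_divergence_sq_mul_eq_zero {ι : Type*} {d : ℕ} {s : Finset ι} {K : ι → Set (E d)}
    (h : IsCellFamily s K) {v : E d → ℝ} {F : E d → E d}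
    (hv : ∃ C : ℝ≥0, LipschitzWith C ((⋃ i ∈ s, K i).indicator v))
    (hF : ∀ᵐ x ∂(volume.restrict (interior (⋃ i ∈ s, K i))), DifferentiableAt ℝ F x)
    (hFv : ∀ j, ∃ C : ℝ≥0,
      LipschitzWith C ((⋃ i ∈ s, K i).indicator fun x => v x ^ 2 * F x j)) :
    ∫ x in interior (⋃ i ∈ s, K i),
      (2 * (inner ℝ (F x) (gradient v x) * v x) + divergence F x * v x ^ 2) = 0 := by
  set D := ⋃ i ∈ s, K i with hD
  have hDc : IsCompact D := h.isCompact_biUnion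
  obtain ⟨Cv, hCv⟩ := hv
  choose C hC using hFv
  set g : Fin d → E d → ℝ := fun j => D.indicator fun x => v x ^ 2 * F x j with hg
  set e : Fin d → E d := fun j => EuclideanSpace.single j 1
  have hsupp : ∀ j, HasCompactSupport (g j) := fun j =>
    HasCompactSupport.intro hDc fun x hx => indicator_of_notMem hx _
  -- Off the closed set D the extension is locally zero, and D differs from its interior by a null
  -- set. The integral over the interior is thus one over the whole space.
  have hout : ∀ j, ∀ᵐ x, x ∉ interior D → lineDeriv ℝ (g j) x (e j) = 0 := fun j => by
    filter_upwards [h.interior_biUnion_ae_eq_biUnion.mem_iff] with x hx hxi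
    rw [hx] at hxi
    have h0 : g j =ᶠ[𝓝 x] fun _ => 0 := by
      filter_upwards [hDc.isClosed.isOpen_compl.mem_nhds hxi] with y hy
      exact indicator_of_notMem hy _
    rw [h0.lineDeriv_eq]
    simp [lineDeriv]
  have hzero : ∀ j, ∫ x in interior D, lineDeriv ℝ (g j) x (e j) = 0 := fun j => by
    rw [setIntegral_eq_integral_of_ae_compl_eq_zero (hout j)]
    exact integral_lineDeriv_eq_zero (hC j) (hsupp j) (e j)
  have hfin : IsFiniteMeasure (volume.restrict (interior D)) := h.isFiniteMeasure_restrict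
  have hintble : ∀ j, IntegrableOn (fun x => lineDeriv ℝ (g j) x (e j)) (interior D) := fun j =>
    (((hC j).memLp_lineDeriv (μ := volume) (e j)).restrict (interior D)).integrable le_top
  have hsum : ∫ x in interior D, ∑ j, lineDeriv ℝ (g j) x (e j) = 0 := by
    rw [integral_finsetSum _ fun j _ => hintble j]
    simp [hzero]
  rw [← hsum]
  refine integral_congr_ae ?_
  -- Rademacher's theorem provides differentiability of v almost everywhere, which justifies the
  -- product rule below.
  filter_upwards [hF, ae_restrict_of_ae (hCv.ae_differentiableAt (μ := volume)),
    ae_restrict_mem isOpen_interior.measurableSet] with x hFx hvx hxi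
  have hnhds : ∀ {G : E d → ℝ}, D.indicator G =ᶠ[𝓝 x] G := by
    intro G
    filter_upwards [mem_interior_iff_mem_nhds.1 hxi] with y hy
    exact indicator_of_mem hy _
  have hvx' : DifferentiableAt ℝ v x := hvx.congr_of_eventuallyEq hnhds.symm
  have hFj : ∀ j, DifferentiableAt ℝ (fun y => F y j) x := fun j =>
    (EuclideanSpace.proj (𝕜 := ℝ) j).differentiableAt.comp x hFx
  have hterm : ∀ j, lineDeriv ℝ (g j) x (e j) =
      2 * (F x j * fderiv ℝ v x (e j) * v x) + fderiv ℝ (fun y => F y j) x (e j) * v x ^ 2 := by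
    intro j
    have hd : HasFDerivAt (fun y => v y ^ 2 * F y j) _ x :=
      (hvx'.hasFDerivAt.pow 2).mul (hFj j).hasFDerivAt
    rw [hnhds.lineDeriv_eq, (hd.hasLineDerivAt (e j)).lineDeriv]
    simp
    ring
  rw [Finset.sum_congr rfl fun j _ => hterm j, divergence_eq_sum_fderiv_apply hFx,
    inner_gradient_eq_sum, Finset.sum_add_distrib, ← Finset.mul_sum, ← Finset.sum_mul,
    ← Finset.sum_mul]

/-! ### Determinants along a segment of linear maps. -/

/-- Jacobi's formula in polynomial form. With M(s) the matrix at s and q its inverse, M(r) = (1 + (r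
- s)(b - a)q) M(s), and the derivative of det(1 + hN) at h = 0 is the trace of N. -/
theorem exists_polynomial_det_segment_matrix {n : Type*} [Fintype n] [DecidableEq n]
    (a b : Matrix n n ℝ) : ∃ P : Polynomial ℝ, (∀ s, P.eval s = ((1 - s) • a + s • b).det) ∧
      ∀ s q, ((1 - s) • a + s • b) * q = 1 →
        P.derivative.eval s = P.eval s * ((b - a) * q).trace := by
  have heval : ∀ (M N : Matrix n n ℝ) (s : ℝ),
      (Matrix.det (M.map Polynomial.C + (Polynomial.X : Polynomial ℝ) • N.map Polynomial.C)).eval s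
        = (M + s • N).det := fun M N s => by
    rw [← Polynomial.coe_evalRingHom, RingHom.map_det]
    congr 1
    ext i j
    simp
    ring
  have hP : ∀ s, (Matrix.det (a.map Polynomial.C + (Polynomial.X : Polynomial ℝ) •
      (b - a).map Polynomial.C)).eval s = ((1 - s) • a + s • b).det := fun s => by
    rw [heval]
    congr 1
    module
  refine ⟨_, hP, fun s q hq => ?_⟩
  set P := Matrix.det (a.map Polynomial.C + (Polynomial.X : Polynomial ℝ) •
      (b - a).map Polynomial.C)
  set Q := Matrix.det (1 + (Polynomial.X : Polynomial ℝ) • ((b - a) * q).map Polynomial.C) with hQ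
  have hQe : ∀ h, Q.eval h = (1 + h • ((b - a) * q)).det := fun h => by
    have := heval 1 ((b - a) * q) h
    rwa [Matrix.map_one _ (map_zero _) (map_one _)] at this
  have hcomp : ∀ r, P.eval r = P.eval s * Q.eval (r - s) := fun r => by
    rw [hP, hP, hQe, mul_comm, ← Matrix.det_mul]
    congr 1
    rw [add_mul, one_mul, Matrix.smul_mul, mul_assoc, mul_eq_one_comm.1 hq, mul_one]
    module
  have h1 : HasDerivAt (fun r => P.eval r) (P.derivative.eval s) s := P.hasDerivAt s
  have h2 : HasDerivAt (fun r => P.eval s * Q.eval (r - s))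
      (P.eval s * Q.derivative.eval 0) s := by
    have h3 : HasDerivAt (fun h => Q.eval h) (Q.derivative.eval 0) (s - s) := by
      rw [sub_self]; exact Q.hasDerivAt 0
    exact (h3.comp_sub_const s s).const_mul _
  rw [show (fun r => P.eval r) = fun r => P.eval s * Q.eval (r - s) from funext hcomp] at h1
  rw [h1.unique h2, hQ, Matrix.derivative_det_one_add_X_smul]

section Determinant

variable {V : Type*} [AddCommGroup V] [Module ℝ V] [FiniteDimensional ℝ V]

theorem exists_polynomial_det_segment (a b : Module.End ℝ V) :
    ∃ P : Polynomial ℝ, (∀ s, P.eval s = LinearMap.det ((1 - s) • a + s • b)) ∧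
      ∀ s q, ((1 - s) • a + s • b) * q = 1 →
        P.derivative.eval s = P.eval s * LinearMap.trace ℝ V ((b - a) * q) := by
  let e := Module.finBasis ℝ V
  let φ := LinearMap.toMatrixAlgEquiv e
  obtain ⟨P, hP, hP'⟩ := exists_polynomial_det_segment_matrix (φ a) (φ b)
  refine ⟨P, fun s => ?_, fun s q hq => ?_⟩
  · rw [hP, ← LinearMap.det_toMatrix e]
    congr 1
    exact (by simp : φ ((1 - s) • a + s • b) = _).symm
  · rw [hP' s (φ q) (by rw [← map_smul, ← map_smul, ← map_add, ← map_mul, hq, map_one]),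
      LinearMap.trace_eq_matrix_trace ℝ e, ← map_sub, ← map_mul]
    rfl

/-- A polynomial without zeros on [0, 1] has the same sign at both ends. -/
theorem det_div_det_pos {a b : Module.End ℝ V}
    (h : ∀ s ∈ Icc (0 : ℝ) 1, LinearMap.det ((1 - s) • a + s • b) ≠ 0) :
    0 < LinearMap.det b / LinearMap.det a := by
  obtain ⟨P, hP, -⟩ := exists_polynomial_det_segment a b
  have h0 : P.eval 0 = LinearMap.det a := by simp [hP]
  have h1 : P.eval 1 = LinearMap.det b := by simp [hP]
  have hne : ∀ s ∈ Icc (0 : ℝ) 1, P.eval s ≠ 0 := fun s hs => hP s ▸ h s hs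
  rw [← h0, ← h1]
  by_contra hcon
  have hneg : P.eval 1 * P.eval 0 ≤ 0 := by
    rcases div_nonpos_iff.1 (not_lt.1 hcon) with ⟨h1, h2⟩ | ⟨h1, h2⟩
    · exact mul_nonpos_of_nonneg_of_nonpos h1 h2
    · exact mul_nonpos_of_nonpos_of_nonneg h1 h2
  have hmem : (0 : ℝ) ∈ uIcc (P.eval 0) (P.eval 1) := by
    rw [mem_uIcc]
    rcases mul_nonpos_iff.1 hneg with h | h
    · exact .inl ⟨h.2, h.1⟩
    · exact .inr h
  obtain ⟨s, hs, hs0⟩ := intermediate_value_uIcc (f := fun s => P.eval s)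
    P.continuous.continuousOn hmem
  rw [uIcc_of_le zero_le_one] at hs
  exact hne s hs hs0

/-- The trace is the logarithmic derivative P'/P, continuous on [0, 1] because P has no zero there.
-/
theorem exists_abs_trace_le {a b : Module.End ℝ V}
    (h : ∀ s ∈ Icc (0 : ℝ) 1, LinearMap.det ((1 - s) • a + s • b) ≠ 0) :
    ∃ C, ∀ s ∈ Icc (0 : ℝ) 1, ∀ q, ((1 - s) • a + s • b) * q = 1 →
      |LinearMap.trace ℝ V ((b - a) * q)| ≤ C := by
  obtain ⟨P, hP, hP'⟩ := exists_polynomial_det_segment a b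
  have hne : ∀ s ∈ Icc (0 : ℝ) 1, P.eval s ≠ 0 := fun s hs => hP s ▸ h s hs
  obtain ⟨C, hC⟩ := isCompact_Icc.exists_bound_of_continuousOn
    (P.derivative.continuous.continuousOn.div P.continuous.continuousOn hne)
  refine ⟨C, fun s hs q hq => ?_⟩
  have := hC s hs
  rwa [Pi.div_apply, hP' s q hq, mul_div_cancel_left₀ _ (hne s hs), Real.norm_eq_abs] at this

/-- The change of the determinant along a segment of invertible maps is controlled by its
logarithmic derivative at some interior point. -/
theorem exists_det_div_det_sub_one_le {a b : Module.End ℝ V}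
    (h : ∀ s ∈ Icc (0 : ℝ) 1, LinearMap.det ((1 - s) • a + s • b) ≠ 0) :
    ∃ s ∈ Ioo (0 : ℝ) 1, ∀ q, ((1 - s) • a + s • b) * q = 1 →
      LinearMap.det b / LinearMap.det a - 1 ≤
        |LinearMap.det b / LinearMap.det a * LinearMap.trace ℝ V ((b - a) * q)| := by
  obtain ⟨P, hP, hP'⟩ := exists_polynomial_det_segment a b
  have hJ := det_div_det_pos h
  have h0 : P.eval 0 = LinearMap.det a := by simp [hP]
  have h1 : P.eval 1 = LinearMap.det b := by simp [hP]
  have hne : ∀ s ∈ Icc (0 : ℝ) 1, P.eval s ≠ 0 := fun s hs => hP s ▸ h s hs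
  -- The mean value theorem for log P on [0, 1]: the trace at s equals log J with J = P(1)/P(0).
  -- `Real.log` is the logarithm of the absolute value, so a negative determinant does no harm.
  obtain ⟨s, hs, hslope⟩ := exists_hasDerivAt_eq_slope (fun s => Real.log (P.eval s))
    (fun s => P.derivative.eval s / P.eval s) zero_lt_one
    (P.continuous.continuousOn.log hne)
    (fun s hs => (P.hasDerivAt s).log (hne s (Ioo_subset_Icc_self hs)))
  refine ⟨s, hs, fun q hq => ?_⟩
  have hne' := hne s (Ioo_subset_Icc_self hs)
  rw [hP' s q hq, mul_div_cancel_left₀ _ hne', h0, h1, sub_zero, div_one,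
    ← Real.log_div (h1 ▸ hne 1 (by simp)) (h0 ▸ hne 0 (by simp))] at hslope
  rw [hslope]
  set J := LinearMap.det b / LinearMap.det a
  have hlog := Real.one_sub_inv_le_log_of_pos hJ
  have : J * (1 - J⁻¹) ≤ J * Real.log J := mul_le_mul_of_nonneg_left hlog hJ.le
  rw [mul_sub, mul_one, mul_inv_cancel₀ hJ.ne'] at this
  exact this.trans (le_abs_self _)

end Determinant

/-! ### Simplicial cells and their images under piecewise affine maps. -/

/-- An interior point could be shifted slightly along a kernel direction without leaving s or
changing its image. The kernel is therefore trivial, and dimension gives surjectivity. -/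
theorem AffineMap.bijective_of_injOn_of_interior_nonempty {V : Type*} [NormedAddCommGroup V]
    [NormedSpace ℝ V] [FiniteDimensional ℝ V] {s : Set V} (hs : (interior s).Nonempty)
    {g : V →ᵃ[ℝ] V} (hg : InjOn g s) : Function.Bijective g := by
  obtain ⟨x, hx⟩ := hs
  have hlin : Function.Injective g.linear := by
    rw [← LinearMap.ker_eq_bot, LinearMap.ker_eq_bot']
    intro v hv
    have hc : Tendsto (fun r : ℝ => x + r • v) (𝓝[>] 0) (𝓝 x) := by
      have : Continuous fun r : ℝ => x + r • v := by fun_prop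
      simpa using (this.tendsto 0).mono_left (nhdsWithin_le_nhds (s := Ioi 0))
    obtain ⟨r, hr, hr0⟩ := ((hc.eventually (mem_interior_iff_mem_nhds.1 hx)).and
      self_mem_nhdsWithin).exists
    have heq : g (x + r • v) = g x := by
      have := g.map_vadd x (r • v)
      rw [vadd_eq_add, vadd_eq_add, map_smul, hv, smul_zero, zero_add, add_comm] at this
      exact this
    have := hg hr (interior_subset hx) heq
    have hr0' : r ≠ 0 := ne_of_gt hr0
    simpa [hr0'] using this
  exact g.linear_bijective_iff.1 ⟨hlin, LinearMap.injective_iff_surjective.1 hlin⟩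

theorem AffineEquiv.image_interior {V : Type*} [NormedAddCommGroup V] [NormedSpace ℝ V]
    [FiniteDimensional ℝ V] (g : V ≃ᵃ[ℝ] V) (s : Set V) :
    g '' interior s = interior (g '' s) :=
  (AffineEquiv.toContinuousAffineEquiv g).toHomeomorph.image_interior s

namespace Triangulation

variable {d : ℕ} {M : Triangulation d} {σ τ : Finset (E d)}

theorem mem_cells : σ ∈ M.cells ↔ σ ∈ M.faces ∧ σ.card = d + 1 := by
  simp [cells]

theorem region_eq : M.region = ⋃ σ ∈ M.cells, convexHull ℝ (σ : Set (E d)) := by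
  ext x
  simp only [Geometry.SimplicialComplex.mem_space_iff, mem_iUnion, exists_prop]
  constructor
  · rintro ⟨s, hs, hx⟩
    obtain ⟨σ, hσ, hsσ, hc⟩ := M.pure_faces s hs
    exact ⟨σ, mem_cells.2 ⟨hσ, hc⟩, convexHull_mono (by exact_mod_cast hsσ) hx⟩
  · rintro ⟨σ, hσ, hx⟩
    exact ⟨σ, (mem_cells.1 hσ).1, hx⟩

theorem hull_subset_region (hσ : σ ∈ M.cells) : convexHull ℝ (σ : Set (E d)) ⊆ M.region := by
  rw [region_eq]
  exact subset_biUnion_of_mem (u := fun σ : Finset (E d) => convexHull ℝ (σ : Set (E d))) hσ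

theorem interior_hull_nonempty (hσ : σ ∈ M.cells) :
    (interior (convexHull ℝ (σ : Set (E d)))).Nonempty := by
  obtain ⟨hf, hc⟩ := mem_cells.1 hσ
  rw [interior_convexHull_nonempty_iff_affineSpan_eq_top]
  have := (M.indep hf).affineSpan_eq_top_iff_card_eq_finrank_add_one.2 (by simp [hc])
  simpa using this

/-- Conformity places the intersection in the hull of the common vertices; these are fewer than d +
1, too few to span an interior. -/
theorem interior_hull_inter_eq_empty (hσ : σ ∈ M.cells) (hτ : τ ∈ M.cells) (hne : σ ≠ τ) :
    interior (convexHull ℝ (σ : Set (E d)) ∩ convexHull ℝ (τ : Set (E d))) = ∅ := by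
  by_contra hcon
  obtain ⟨hf, hc⟩ := mem_cells.1 hσ
  obtain ⟨hf', hc'⟩ := mem_cells.1 hτ
  have hn := (nonempty_iff_ne_empty.2 hcon).mono
    (interior_mono (M.inter_subset_convexHull hf hf'))
  rw [interior_convexHull_nonempty_iff_affineSpan_eq_top] at hn
  have hind : AffineIndependent ℝ ((↑) : (σ ∩ τ : Finset (E d)) → E d) :=
    (M.indep hf).mono (by simp)
  have := hind.affineSpan_eq_top_iff_card_eq_finrank_add_one.1 (by
    rwa [Subtype.range_coe_subtype, Finset.setOfPred_mem, Finset.coe_inter])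
  have hlt : (σ ∩ τ).card < σ.card := by
    refine Finset.card_lt_card (Finset.ssubset_iff_subset_ne.2 ⟨Finset.inter_subset_left, ?_⟩)
    intro h
    exact hne (Finset.eq_of_subset_of_card_le (Finset.inter_eq_left.1 h) (by omega))
  simp at this
  omega

variable {φ : E d → E d}

theorem IsP1Map.exists_affineEquiv (h : M.IsP1Map φ) (hφ : InjOn φ M.region) (hσ : σ ∈ M.cells) :
    ∃ g : E d ≃ᵃ[ℝ] E d, EqOn φ g (convexHull ℝ (σ : Set (E d))) := by
  obtain ⟨g, hg⟩ := h.2 σ hσ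
  have hb := AffineMap.bijective_of_injOn_of_interior_nonempty (interior_hull_nonempty hσ)
    ((hφ.mono (hull_subset_region hσ)).congr hg)
  exact ⟨AffineEquiv.ofBijective hb, hg⟩

theorem image_region : φ '' M.region = ⋃ σ ∈ M.cells, φ '' convexHull ℝ (σ : Set (E d)) := by
  rw [region_eq, image_iUnion₂]

theorem interior_image_hull {g : E d ≃ᵃ[ℝ] E d} (hg : EqOn φ g (convexHull ℝ (σ : Set (E d)))) :
    interior (φ '' convexHull ℝ (σ : Set (E d))) =
      g '' interior (convexHull ℝ (σ : Set (E d))) := by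
  rw [hg.image_eq, AffineEquiv.image_interior]

theorem IsP1Map.isCellFamily (h : M.IsP1Map φ) (hφ : InjOn φ M.region) :
    IsCellFamily M.cells fun σ => φ '' convexHull ℝ (σ : Set (E d)) where
  isCompact σ hσ := by
    refine (σ.finite_toSet.isCompact_convexHull ℝ).image_of_continuousOn ?_
    exact h.1.mono (hull_subset_region hσ)
  convex σ hσ := by
    obtain ⟨g, hg⟩ := h.2 σ hσ
    rw [hg.image_eq]
    exact (convex_convexHull ℝ _).affine_image g
  disjoint σ hσ τ hτ hne := by
    obtain ⟨g, hg⟩ := h.exists_affineEquiv hφ hσ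
    -- Global injectivity makes the intersection of the images the image of the intersection. There
    -- the map agrees with an affine equivalence, which preserves emptiness of the interior.
    rw [Function.onFun, disjoint_iff_inter_eq_empty, ← interior_inter,
      ← hφ.image_inter (hull_subset_region hσ) (hull_subset_region hτ),
      (hg.mono inter_subset_left).image_eq]
    rw [← AffineEquiv.image_interior, interior_hull_inter_eq_empty hσ hτ hne, image_empty]

theorem invFunOn_eq_symm (hφ : InjOn φ M.region) (hσ : σ ∈ M.cells) {g : E d ≃ᵃ[ℝ] E d}
    (hg : EqOn φ g (convexHull ℝ (σ : Set (E d)))) {x : E d}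
    (hx : x ∈ φ '' convexHull ℝ (σ : Set (E d))) :
    Function.invFunOn φ M.region x = g.symm x := by
  obtain ⟨y, hy, rfl⟩ := hx
  rw [hφ.leftInvOn_invFunOn (hull_subset_region hσ hy), hg hy, g.symm_apply_apply]

end Triangulation

theorem AffineMap.hasFDerivAt_toContinuousLinearMap {V : Type*} [NormedAddCommGroup V]
    [NormedSpace ℝ V] [FiniteDimensional ℝ V] (g : V →ᵃ[ℝ] V) (x : V) :
    HasFDerivAt g (LinearMap.toContinuousLinearMap g.linear) x := by
  rw [g.decomp]
  exact (LinearMap.toContinuousLinearMap g.linear).hasFDerivAt.add_const _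

theorem AffineEquiv.linear_mul_symm_linear {V : Type*} [AddCommGroup V] [Module ℝ V]
    (g : V ≃ᵃ[ℝ] V) :
    ((g : V →ᵃ[ℝ] V).linear * (g.symm : V →ᵃ[ℝ] V).linear : Module.End ℝ V) = 1 := by
  ext v
  simp

theorem divergence_affineMap {d : ℕ} (g : E d →ᵃ[ℝ] E d) (x : E d) :
    divergence g x = LinearMap.trace ℝ (E d) g.linear := by
  rw [divergence, (AffineMap.hasFDerivAt_toContinuousLinearMap g x).fderiv,
    LinearMap.trace_eq_sum_inner _ (EuclideanSpace.basisFun (Fin d) ℝ)]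
  simp [EuclideanSpace.inner_single_left]

theorem divergence_congr {d : ℕ} {F G : E d → E d} {x : E d} (h : F =ᶠ[𝓝 x] G) :
    divergence F x = divergence G x := by
  rw [divergence, divergence, h.fderiv_eq]

/-! ### One time step of the ALE mapping on a cell. -/

namespace Scheme

variable {d : ℕ} {S : Scheme d} {n : ℕ} {t : ℝ} {σ : Finset (E d)}

/-- The standing assumptions on the time levels and the ALE mappings. -/
structure Admissible (S : Scheme d) : Prop where
  T_pos : 0 < S.T
  N_pos : 0 < S.N
  isP1Map : ∀ n ≤ S.N, S.mesh.IsP1Map (S.A (S.time n))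
  injOn : ∀ n < S.N, ∀ t ∈ Icc (S.time n) (S.time (n + 1)), InjOn (S.interp n t) S.mesh.region

theorem time_succ (S : Scheme d) (n : ℕ) : S.time (n + 1) = S.time n + S.dt := by
  simp [time]
  ring

namespace Admissible

theorem dt_pos (h : S.Admissible) : 0 < S.dt :=
  div_pos h.T_pos (Nat.cast_pos.2 h.N_pos)

theorem interp_left (h : S.Admissible) (n : ℕ) : S.interp n (S.time n) = S.A (S.time n) := by
  funext Y
  simp [interp, time_succ, h.dt_pos.ne']

theorem interp_right (h : S.Admissible) (n : ℕ) :
    S.interp n (S.time (n + 1)) = S.A (S.time (n + 1)) := by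
  funext Y
  simp [interp, time_succ, h.dt_pos.ne']

theorem interp_eq (h : S.Admissible) (n : ℕ) (t : ℝ) (Y : E d) :
    S.interp n t Y = (1 - (t - S.time n) / S.dt) • S.A (S.time n) Y +
      ((t - S.time n) / S.dt) • S.A (S.time (n + 1)) Y := by
  rw [interp, add_comm]
  congr 2
  rw [time_succ]
  field_simp [h.dt_pos.ne']
  ring

theorem time_le_time_succ (h : S.Admissible) (n : ℕ) : S.time n ≤ S.time (n + 1) := by
  rw [time_succ]
  linarith [h.dt_pos]

theorem injOn_A (h : S.Admissible) (hn : n ≤ S.N) : InjOn (S.A (S.time n)) S.mesh.region := by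
  rcases hn.lt_or_eq with hlt | rfl
  · rw [← h.interp_left]
    exact h.injOn n hlt _ (left_mem_Icc.2 (h.time_le_time_succ n))
  -- No step starts at the last level, so injectivity is read off at the right end of the last step.
  · obtain ⟨k, hk⟩ := Nat.exists_eq_succ_of_ne_zero h.N_pos.ne'
    rw [hk, Nat.succ_eq_add_one, ← h.interp_right]
    exact h.injOn k (by omega) _ (right_mem_Icc.2 (h.time_le_time_succ k))

theorem isP1Map_interp (h : S.Admissible) (hn : n < S.N) (t : ℝ) :
    S.mesh.IsP1Map (S.interp n t) := by
  have h0 := h.isP1Map n hn.le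
  have h1 := h.isP1Map (n + 1) hn
  have hc : ContinuousOn (S.interp n t) S.mesh.region := by
    have h0c := h0.1
    have h1c := h1.1
    unfold interp
    fun_prop
  refine ⟨hc, fun σ hσ => ?_⟩
  obtain ⟨g0, hg0⟩ := h0.2 σ hσ
  obtain ⟨g1, hg1⟩ := h1.2 σ hσ
  refine ⟨((t - S.time n) / S.dt) • g1 + ((S.time (n + 1) - t) / S.dt) • g0, fun Y hY => ?_⟩
  rw [interp, hg0 hY, hg1 hY]
  rfl

theorem isCellFamily (h : S.Admissible) (hn : n ≤ S.N) :
    IsCellFamily S.mesh.cells (S.cell n) :=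
  (h.isP1Map n hn).isCellFamily (h.injOn_A hn)

end Admissible

theorem closedDom_eq (S : Scheme d) (n : ℕ) : S.closedDom n = ⋃ σ ∈ S.mesh.cells, S.cell n σ :=
  Triangulation.image_region

theorem dom_eq (S : Scheme d) (n : ℕ) :
    S.dom n = interior (⋃ σ ∈ S.mesh.cells, S.cell n σ) := by
  rw [dom, closedDom_eq]

/-- The affine maps that represent the ALE mappings of a time step on one reference cell. -/
structure StepPieces (S : Scheme d) (n : ℕ) (σ : Finset (E d)) where
  g0 : E d ≃ᵃ[ℝ] E d
  g1 : E d ≃ᵃ[ℝ] E d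
  eqOn0 : EqOn (S.A (S.time n)) g0 (convexHull ℝ (σ : Set (E d)))
  eqOn1 : EqOn (S.A (S.time (n + 1))) g1 (convexHull ℝ (σ : Set (E d)))

theorem Admissible.nonempty_stepPieces (h : S.Admissible) (hn : n < S.N)
    (hσ : σ ∈ S.mesh.cells) : Nonempty (S.StepPieces n σ) := by
  obtain ⟨g0, hg0⟩ := (h.isP1Map n hn.le).exists_affineEquiv (h.injOn_A hn.le) hσ
  obtain ⟨g1, hg1⟩ := (h.isP1Map (n + 1) hn).exists_affineEquiv (h.injOn_A hn) hσ
  exact ⟨⟨g0, g1, hg0, hg1⟩⟩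

namespace StepPieces

variable (p : S.StepPieces n σ)

/-- The linear part of the first map of the step. -/
noncomputable def l0 : Module.End ℝ (E d) := (p.g0 : E d →ᵃ[ℝ] E d).linear

/-- The linear part of the second map of the step. -/
noncomputable def l1 : Module.End ℝ (E d) := (p.g1 : E d →ᵃ[ℝ] E d).linear

theorem exists_interp (h : S.Admissible) (hn : n < S.N) (hσ : σ ∈ S.mesh.cells)
    (ht : t ∈ Icc (S.time n) (S.time (n + 1))) :
    ∃ g : E d ≃ᵃ[ℝ] E d, EqOn (S.interp n t) g (convexHull ℝ (σ : Set (E d))) ∧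
      (g : E d →ᵃ[ℝ] E d).linear =
        (1 - (t - S.time n) / S.dt) • p.l0 + ((t - S.time n) / S.dt) • p.l1 := by
  set r := (t - S.time n) / S.dt
  let G : E d →ᵃ[ℝ] E d := (1 - r) • (p.g0 : E d →ᵃ[ℝ] E d) + r • (p.g1 : E d →ᵃ[ℝ] E d)
  have hG : EqOn (S.interp n t) G (convexHull ℝ (σ : Set (E d))) := fun Y hY => by
    rw [h.interp_eq, p.eqOn0 hY, p.eqOn1 hY]
    rfl
  have hb := AffineMap.bijective_of_injOn_of_interior_nonempty
    (Triangulation.interior_hull_nonempty hσ)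
    (((h.injOn n hn t ht).mono (Triangulation.hull_subset_region hσ)).congr hG)
  exact ⟨AffineEquiv.ofBijective hb, hG, rfl⟩

theorem det_segment_ne_zero (h : S.Admissible) (hn : n < S.N) (hσ : σ ∈ S.mesh.cells) :
    ∀ s ∈ Icc (0 : ℝ) 1, LinearMap.det ((1 - s) • p.l0 + s • p.l1) ≠ 0 := by
  intro s hs
  have hdt := h.dt_pos
  have ht : S.time n + s * S.dt ∈ Icc (S.time n) (S.time (n + 1)) := by
    rw [time_succ]
    constructor <;> nlinarith [hs.1, hs.2]
  obtain ⟨g, -, hg⟩ := p.exists_interp h hn hσ ht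
  rw [add_sub_cancel_left, mul_div_cancel_right₀ _ hdt.ne'] at hg
  rw [← hg]
  intro h0
  have := congrArg LinearMap.det (AffineEquiv.linear_mul_symm_linear g)
  rw [map_mul, h0, zero_mul, map_one] at this
  exact zero_ne_one this

theorem meshVel_eqOn (h : S.Admissible) (hn : n < S.N) (hσ : σ ∈ S.mesh.cells)
    (ht : t ∈ Icc (S.time n) (S.time (n + 1))) {g : E d ≃ᵃ[ℝ] E d}
    (hg : EqOn (S.interp n t) g (convexHull ℝ (σ : Set (E d)))) :
    EqOn (S.meshVel n t)
      ((S.dt⁻¹ • ((p.g1 : E d →ᵃ[ℝ] E d) - (p.g0 : E d →ᵃ[ℝ] E d))).comp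
        (g.symm : E d →ᵃ[ℝ] E d))
      (S.interp n t '' convexHull ℝ (σ : Set (E d))) := by
  intro x hx
  have hy : g.symm x ∈ convexHull ℝ (σ : Set (E d)) := by
    obtain ⟨y, hy, rfl⟩ := hx
    rwa [hg hy, g.symm_apply_apply]
  rw [meshVel, interpInv, Triangulation.invFunOn_eq_symm (h.injOn n hn t ht) hσ hg hx,
    p.eqOn0 hy, p.eqOn1 hy]
  rfl

/-- On a cell the velocity is the affine map (g1 - g0)/Δt composed with the inverse of the current
mapping. Its divergence is thus constant there and, by Jacobi's formula, is the time derivative of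
the log-determinant. -/
theorem divergence_meshVel (h : S.Admissible) (hn : n < S.N) (hσ : σ ∈ S.mesh.cells)
    (ht : t ∈ Icc (S.time n) (S.time (n + 1))) {g : E d ≃ᵃ[ℝ] E d}
    (hg : EqOn (S.interp n t) g (convexHull ℝ (σ : Set (E d)))) {x : E d}
    (hx : x ∈ interior (S.interp n t '' convexHull ℝ (σ : Set (E d)))) :
    divergence (S.meshVel n t) x = S.dt⁻¹ *
      LinearMap.trace ℝ (E d) ((p.l1 - p.l0) * (g.symm : E d →ᵃ[ℝ] E d).linear) := by
  rw [divergence_congr (Filter.mem_of_superset (mem_interior_iff_mem_nhds.1 hx)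
    (p.meshVel_eqOn h hn hσ ht hg)), divergence_affineMap, AffineMap.comp_linear,
    AffineMap.smul_linear, AffineMap.sub_linear, LinearMap.smul_comp, map_smul, smul_eq_mul]
  rfl

theorem transfer_eqOn (h : S.Admissible) (hn : n < S.N) (hσ : σ ∈ S.mesh.cells) :
    EqOn (S.transfer n (n + 1))
      ((p.g1 : E d →ᵃ[ℝ] E d).comp (p.g0.symm : E d →ᵃ[ℝ] E d)) (S.cell n σ) := by
  intro x hx
  have hy : p.g0.symm x ∈ convexHull ℝ (σ : Set (E d)) := by
    obtain ⟨y, hy, rfl⟩ := hx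
    rwa [p.eqOn0 hy, p.g0.symm_apply_apply]
  rw [transfer, Triangulation.invFunOn_eq_symm (h.injOn_A hn.le) hσ p.eqOn0 hx, p.eqOn1 hy]
  rfl

theorem transfer_back_eqOn (h : S.Admissible) (hn : n < S.N) (hσ : σ ∈ S.mesh.cells) :
    EqOn (S.transfer (n + 1) n)
      ((p.g0 : E d →ᵃ[ℝ] E d).comp (p.g1.symm : E d →ᵃ[ℝ] E d)) (S.cell (n + 1) σ) := by
  intro x hx
  have hy : p.g1.symm x ∈ convexHull ℝ (σ : Set (E d)) := by
    obtain ⟨y, hy, rfl⟩ := hx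
    rwa [p.eqOn1 hy, p.g1.symm_apply_apply]
  rw [transfer, Triangulation.invFunOn_eq_symm (h.injOn_A hn) hσ p.eqOn1 hx, p.eqOn0 hy]
  rfl

theorem det_comp_symm :
    LinearMap.det ((p.g1 : E d →ᵃ[ℝ] E d).comp (p.g0.symm : E d →ᵃ[ℝ] E d)).linear =
      LinearMap.det p.l1 / LinearMap.det p.l0 := by
  have h1 := congrArg LinearMap.det (AffineEquiv.linear_mul_symm_linear p.g0)
  rw [map_mul, map_one] at h1
  rw [AffineMap.comp_linear, LinearMap.det_comp, div_eq_mul_inv]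
  congr 1
  exact eq_inv_of_mul_eq_one_right h1

theorem jac_eq (h : S.Admissible) (hn : n < S.N) (hσ : σ ∈ S.mesh.cells) {x : E d}
    (hx : x ∈ interior (S.cell n σ)) :
    S.jac n x = LinearMap.det p.l1 / LinearMap.det p.l0 := by
  rw [jac, Filter.EventuallyEq.fderiv_eq (Filter.mem_of_superset (mem_interior_iff_mem_nhds.1 hx)
    (p.transfer_eqOn h hn hσ)), (AffineMap.hasFDerivAt_toContinuousLinearMap _ x).fderiv,
    ← p.det_comp_symm]
  rfl

/-- Both factors are constant on the cell: pulling an interior point back to the start of the step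
keeps it inside the image of the same reference cell. -/
theorem jac_mul_divergence (h : S.Admissible) (hn : n < S.N) (hσ : σ ∈ S.mesh.cells)
    (ht : t ∈ Icc (S.time n) (S.time (n + 1))) {g : E d ≃ᵃ[ℝ] E d}
    (hg : EqOn (S.interp n t) g (convexHull ℝ (σ : Set (E d)))) {x : E d}
    (hx : x ∈ interior (S.interp n t '' convexHull ℝ (σ : Set (E d)))) :
    S.jac n (S.A (S.time n) (S.interpInv n t x)) * divergence (S.meshVel n t) x =
      LinearMap.det p.l1 / LinearMap.det p.l0 * (S.dt⁻¹ *
        LinearMap.trace ℝ (E d) ((p.l1 - p.l0) * (g.symm : E d →ᵃ[ℝ] E d).linear)) := by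
  rw [p.divergence_meshVel h hn hσ ht hg hx]
  congr 1
  apply p.jac_eq h hn hσ
  rw [interpInv, Triangulation.invFunOn_eq_symm (h.injOn n hn t ht) hσ hg (interior_subset hx)]
  rw [Triangulation.interior_image_hull hg] at hx
  obtain ⟨y, hy, rfl⟩ := hx
  rw [g.symm_apply_apply, cell, Triangulation.interior_image_hull p.eqOn0,
    p.eqOn0 (interior_subset hy)]
  exact mem_image_of_mem _ hy

end StepPieces

/-! ### The constants α₁ and α₂ and the Jacobian bound. -/

theorem alpha1_nonneg (S : Scheme d) (n : ℕ) : 0 ≤ S.alpha1 n := ENNReal.toReal_nonneg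

theorem alpha2_nonneg (S : Scheme d) (n : ℕ) : 0 ≤ S.alpha2 n := by
  unfold alpha2
  split_ifs
  exacts [ENNReal.toReal_nonneg, le_rfl]

/-- Finiteness is essential because `alpha2` applies `toReal`, which sends ∞ to 0. The trace bound
holds uniformly over the whole segment, hence uniformly in t. -/
theorem Admissible.iSup_linfty_ne_top (h : S.Admissible) (hn : n < S.N) :
    (⨆ t ∈ Ioo (S.time n) (S.time (n + 1)),
      linfty (S.domAt n t) (fun x =>
        S.jac n (S.A (S.time n) (S.interpInv n t x)) * divergence (S.meshVel n t) x)) ≠ ∞ := by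
  have hdt := h.dt_pos
  have hbound : ∀ σ ∈ S.mesh.cells, ∃ C : ℝ, ∀ t ∈ Ioo (S.time n) (S.time (n + 1)),
      ∀ x ∈ interior (S.interp n t '' convexHull ℝ (σ : Set (E d))),
        |S.jac n (S.A (S.time n) (S.interpInv n t x)) * divergence (S.meshVel n t) x| ≤ C := by
    intro σ hσ
    obtain ⟨p⟩ := h.nonempty_stepPieces hn hσ
    obtain ⟨C, hC⟩ := exists_abs_trace_le (p.det_segment_ne_zero h hn hσ)
    refine ⟨|LinearMap.det p.l1 / LinearMap.det p.l0| * (S.dt⁻¹ * C), fun t ht x hx => ?_⟩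
    have ht' := Ioo_subset_Icc_self ht
    obtain ⟨g, hg, hgl⟩ := p.exists_interp h hn hσ ht'
    rw [p.jac_mul_divergence h hn hσ ht' hg hx, abs_mul, abs_mul,
      abs_of_nonneg (inv_nonneg.2 hdt.le)]
    gcongr
    refine hC ((t - S.time n) / S.dt) ⟨?_, ?_⟩ _ ?_
    · exact div_nonneg (sub_nonneg.2 ht'.1) hdt.le
    · rw [div_le_one hdt]
      linarith [ht'.2, S.time_succ n]
    · rw [← hgl, AffineEquiv.linear_mul_symm_linear]
  choose! C hC using hbound
  refine ne_top_of_le_ne_top (ENNReal.ofReal_ne_top (r := ∑ σ ∈ S.mesh.cells, |C σ|))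
    (iSup₂_le fun t ht => ?_)
  have hcf := (h.isP1Map_interp hn t).isCellFamily (h.injOn n hn t (Ioo_subset_Icc_self ht))
  rw [linfty, eLpNorm_exponent_top]
  refine eLpNormEssSup_le_of_ae_bound ?_
  rw [domAt, Triangulation.image_region]
  filter_upwards [hcf.ae_mem_interior] with x ⟨σ, hσ, hx⟩
  exact ((hC σ hσ t ht x hx).trans (le_abs_self _)).trans
    (Finset.single_le_sum (f := fun σ => |C σ|) (fun _ _ => abs_nonneg _) hσ)

/-- The Jacobian of a time step exceeds one by at most `Δt α₂`. -/
theorem StepPieces.det_div_det_le (p : S.StepPieces n σ) (h : S.Admissible) (hn : n < S.N)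
    (hσ : σ ∈ S.mesh.cells) :
    LinearMap.det p.l1 / LinearMap.det p.l0 ≤ 1 + S.dt * S.alpha2 n := by
  have hdt := h.dt_pos
  obtain ⟨s, hs, hJ⟩ := exists_det_div_det_sub_one_le (p.det_segment_ne_zero h hn hσ)
  have ht : S.time n + s * S.dt ∈ Ioo (S.time n) (S.time (n + 1)) := by
    rw [time_succ]
    constructor <;> nlinarith [hs.1, hs.2]
  set t := S.time n + s * S.dt with htdef
  have ht' := Ioo_subset_Icc_self ht
  obtain ⟨g, hg, hgl⟩ := p.exists_interp h hn hσ ht'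
  rw [htdef, add_sub_cancel_left, mul_div_cancel_right₀ _ hdt.ne'] at hgl
  specialize hJ _ (by rw [← hgl, AffineEquiv.linear_mul_symm_linear g])
  set J := LinearMap.det p.l1 / LinearMap.det p.l0
  set τ := LinearMap.trace ℝ (E d) ((p.l1 - p.l0) * (g.symm : E d →ᵃ[ℝ] E d).linear)
  set U := interior (S.interp n t '' convexHull ℝ (σ : Set (E d))) with hU
  set Θ : E d → ℝ := fun x =>
    S.jac n (S.A (S.time n) (S.interpInv n t x)) * divergence (S.meshVel n t) x with hΘ
  -- The open cell has positive measure, so the constant value taken on it cannot exceed the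
  -- essential supremum over the domain.
  have hUne : volume.restrict U ≠ 0 := by
    rw [Ne, Measure.restrict_eq_zero]
    refine (isOpen_interior.measure_pos volume ?_).ne'
    rw [Triangulation.interior_image_hull hg]
    exact (Triangulation.interior_hull_nonempty hσ).image _
  have hUsub : U ⊆ S.domAt n t :=
    interior_mono (image_mono (Triangulation.hull_subset_region hσ))
  have hconst : Θ =ᵐ[volume.restrict U] fun _ => J * (S.dt⁻¹ * τ) := by
    filter_upwards [ae_restrict_mem isOpen_interior.measurableSet] with x hx
    exact p.jac_mul_divergence h hn hσ ht' hg hx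
  have hle : ‖J * (S.dt⁻¹ * τ)‖ₑ ≤ linfty (S.domAt n t) Θ := by
    rw [← eLpNormEssSup_const (J * (S.dt⁻¹ * τ)) hUne, ← eLpNorm_exponent_top,
      ← eLpNorm_congr_ae hconst]
    exact eLpNorm_mono_measure _ (Measure.restrict_mono hUsub le_rfl)
  have hα : |J * (S.dt⁻¹ * τ)| ≤ S.alpha2 n := by
    rw [alpha2, if_pos hn, ← Real.norm_eq_abs, ← toReal_enorm]
    exact ENNReal.toReal_mono (h.iSup_linfty_ne_top hn)
      (hle.trans (le_iSup₂_of_le t ht le_rfl))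
  have heq : |J * τ| = S.dt * |J * (S.dt⁻¹ * τ)| := by
    rw [← abs_of_pos hdt, ← abs_mul, abs_of_pos hdt]
    congr 1
    field_simp
  have := mul_le_mul_of_nonneg_left hα hdt.le
  linarith

/-- The velocity at level n + 1 belongs to step n, at whose right end the mapping is that of the
time level. -/
theorem Admissible.exists_w_eqOn (h : S.Admissible) (hn : n < S.N) (hσ : σ ∈ S.mesh.cells) :
    ∃ W : E d →ᵃ[ℝ] E d, EqOn (S.w (n + 1)) W (S.cell (n + 1) σ) := by
  obtain ⟨p⟩ := h.nonempty_stepPieces hn hσ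
  have ht := right_mem_Icc.2 (h.time_le_time_succ n)
  obtain ⟨g, hg, -⟩ := p.exists_interp h hn hσ ht
  have := p.meshVel_eqOn h hn hσ ht hg
  rw [h.interp_right] at this
  exact ⟨_, this⟩

theorem Admissible.piecewiseContinuous_w (h : S.Admissible) (hn : n < S.N) :
    PiecewiseContinuous S.mesh.cells (S.cell (n + 1)) (S.w (n + 1)) := fun _ hσ => by
  obtain ⟨W, hW⟩ := h.exists_w_eqOn hn hσ
  exact ⟨W, W.continuous_of_finiteDimensional, hW.mono interior_subset⟩

theorem Admissible.piecewiseContinuous_divergence_w (h : S.Admissible) (hn : n < S.N) :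
    PiecewiseContinuous S.mesh.cells (S.cell (n + 1)) (divergence (S.w (n + 1))) := fun _ hσ => by
  obtain ⟨W, hW⟩ := h.exists_w_eqOn hn hσ
  refine ⟨fun _ => LinearMap.trace ℝ (E d) W.linear, continuous_const, fun x hx => ?_⟩
  rw [divergence_congr (Filter.mem_of_superset (mem_interior_iff_mem_nhds.1 hx) hW),
    divergence_affineMap]

theorem Admissible.ae_differentiableAt_w (h : S.Admissible) (hn : n < S.N) :
    ∀ᵐ x ∂(volume.restrict (S.dom (n + 1))), DifferentiableAt ℝ (S.w (n + 1)) x := by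
  rw [dom_eq]
  filter_upwards [(h.isCellFamily hn).ae_mem_interior] with x ⟨σ, hσ, hx⟩
  obtain ⟨W, hW⟩ := h.exists_w_eqOn hn hσ
  exact (AffineMap.hasFDerivAt_toContinuousLinearMap W x).differentiableAt.congr_of_eventuallyEq
    (Filter.mem_of_superset (mem_interior_iff_mem_nhds.1 hx) hW)

theorem Admissible.ae_abs_divergence_w_le (h : S.Admissible) (hn : n < S.N) :
    ∀ᵐ x ∂(volume.restrict (S.dom (n + 1))),
      |divergence (S.w (n + 1)) x| ≤ S.alpha1 (n + 1) := by
  have hmem := (h.piecewiseContinuous_divergence_w hn).memLp_top (h.isCellFamily hn)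
  rw [← dom_eq] at hmem
  filter_upwards [enorm_ae_le_eLpNormEssSup (divergence (S.w (n + 1)))
    (volume.restrict (S.dom (n + 1)))] with x hx
  rw [alpha1, linfty, ← Real.norm_eq_abs, ← toReal_enorm]
  exact ENNReal.toReal_mono hmem.eLpNorm_ne_top (by rwa [eLpNorm_exponent_top])

/-! ### Regularity of finite element functions and their transfer between levels. -/

/-- A representation of a finite element function by smooth functions on the cells. -/
theorem InVh.exists_contDiff {v : E d → ℝ} (hv : S.InVh n v) (hσ : σ ∈ S.mesh.cells) :
    ∃ P : E d → ℝ, ContDiff ℝ 2 P ∧ EqOn v P (S.cell n σ) := by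
  obtain ⟨p, -, hp⟩ := hv.2.2 σ hσ
  refine ⟨fun x => MvPolynomial.eval (fun i => x i) p, ?_, hp⟩
  have := AnalyticOnNhd.eval_continuousLinearMap' (𝕜 := ℝ)
    (fun i : Fin d => (EuclideanSpace.proj i : E d →L[ℝ] ℝ)) p
  exact contDiffOn_univ.1 (this.contDiffOn uniqueDiffOn_univ)

theorem InVh.piecewiseContinuous {v : E d → ℝ} (hv : S.InVh n v) :
    PiecewiseContinuous S.mesh.cells (S.cell n) v := fun _ hσ => by
  obtain ⟨P, hP, hvP⟩ := hv.exists_contDiff hσ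
  exact ⟨P, hP.continuous, hvP.mono interior_subset⟩

theorem InVh.piecewiseContinuous_gradient {v : E d → ℝ} (hv : S.InVh n v) :
    PiecewiseContinuous S.mesh.cells (S.cell n) (gradient v) := fun _ hσ => by
  obtain ⟨P, hP, hvP⟩ := hv.exists_contDiff hσ
  refine ⟨gradient P, ?_, fun x hx => ?_⟩
  · exact (LinearIsometryEquiv.continuous _).comp (hP.continuous_fderiv (by norm_num))
  · have : v =ᶠ[𝓝 x] P := Filter.mem_of_superset (mem_interior_iff_mem_nhds.1 hx) hvP
    rw [gradient, gradient, this.fderiv_eq]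

theorem InVh.piecewiseContinuous_laplacian {v : E d → ℝ} (hv : S.InVh n v) :
    PiecewiseContinuous S.mesh.cells (S.cell n) (Laplacian.laplacian v) := fun _ hσ => by
  obtain ⟨P, hP, hvP⟩ := hv.exists_contDiff hσ
  refine ⟨Laplacian.laplacian P, ?_, fun x hx => ?_⟩
  · rw [InnerProductSpace.laplacian_eq_iteratedFDeriv_stdOrthonormalBasis]
    refine continuous_finsetSum _ fun i _ => ?_
    exact (ContinuousMultilinearMap.apply ℝ (fun _ : Fin 2 => E d) ℝ _).continuous.comp
      (hP.continuous_iteratedFDeriv le_rfl)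
  · have : v =ᶠ[𝓝 x] P := Filter.mem_of_superset (mem_interior_iff_mem_nhds.1 hx) hvP
    exact (InnerProductSpace.laplacian_congr_nhds this).self_of_nhds

theorem InVh.exists_lipschitzOnWith {v : E d → ℝ} (hv : S.InVh n v) (h : S.Admissible)
    (hn : n ≤ S.N) (hσ : σ ∈ S.mesh.cells) : ∃ C : ℝ≥0, LipschitzOnWith C v (S.cell n σ) := by
  obtain ⟨P, hP, hvP⟩ := hv.exists_contDiff hσ
  have hcf := h.isCellFamily hn
  obtain ⟨C, hC⟩ := (hcf.isCompact σ hσ).exists_bound_of_continuousOn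
    (hP.continuous_fderiv (by norm_num)).continuousOn
  refine ⟨C.toNNReal, fun x hx y hy => ?_⟩
  rw [hvP hx, hvP hy]
  refine (hcf.convex σ hσ).lipschitzOnWith_of_nnnorm_fderiv_le
    (fun x _ => hP.differentiable (by norm_num) x) (fun x hx => ?_) hx hy
  rw [← NNReal.coe_le_coe, coe_nnnorm]
  exact (hC x hx).trans (Real.le_coe_toNNReal C)

theorem InVh.piecewiseContinuous_transfer {v : E d → ℝ} (hv : S.InVh n v) (h : S.Admissible)
    (hn : n < S.N) : PiecewiseContinuous S.mesh.cells (S.cell (n + 1))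
      fun x => v (S.transfer (n + 1) n x) := fun σ hσ => by
  obtain ⟨P, hP, hvP⟩ := hv.exists_contDiff hσ
  obtain ⟨p⟩ := h.nonempty_stepPieces hn hσ
  refine ⟨P ∘ ((p.g0 : E d →ᵃ[ℝ] E d).comp (p.g1.symm : E d →ᵃ[ℝ] E d)),
    hP.continuous.comp (AffineMap.continuous_of_finiteDimensional _), fun x hx => ?_⟩
  have hx' := interior_subset hx
  have hmem : S.transfer (n + 1) n x ∈ S.cell n σ := by
    rw [transfer, Triangulation.invFunOn_eq_symm (h.injOn_A hn) hσ p.eqOn1 hx']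
    obtain ⟨y, hy, rfl⟩ := hx'
    rw [p.eqOn1 hy, p.g1.symm_apply_apply]
    exact mem_image_of_mem _ hy
  simp only
  rw [hvP hmem, p.transfer_back_eqOn h hn hσ hx']
  rfl

/-- Change of variables by the affine map taking the old cell to the new one. Its determinant is
positive, so the absolute value disappears. -/
theorem StepPieces.setIntegral_transfer (p : S.StepPieces n σ) (h : S.Admissible) (hn : n < S.N)
    (hσ : σ ∈ S.mesh.cells) (φ : E d → ℝ) :
    ∫ x in S.cell (n + 1) σ, φ (S.transfer (n + 1) n x) =
      LinearMap.det p.l1 / LinearMap.det p.l0 * ∫ x in S.cell n σ, φ x := by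
  set G := (p.g1 : E d →ᵃ[ℝ] E d).comp (p.g0.symm : E d →ᵃ[ℝ] E d) with hG
  have hcell : S.cell (n + 1) σ = G '' S.cell n σ := by
    rw [cell, cell, p.eqOn0.image_eq, p.eqOn1.image_eq, image_image]
    exact image_congr fun y _ => by simp [hG]
  have hmeas : MeasurableSet (S.cell n σ) :=
    ((h.isCellFamily hn.le).isCompact σ hσ).measurableSet
  have hinj : InjOn G (S.cell n σ) := fun x _ y _ hxy => by simpa [hG] using hxy
  rw [hcell, integral_image_eq_integral_abs_det_fderiv_smul volume hmeas
    (fun x _ => (AffineMap.hasFDerivAt_toContinuousLinearMap G x).hasFDerivWithinAt) hinj]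
  have hdet : (LinearMap.toContinuousLinearMap G.linear).det =
      LinearMap.det p.l1 / LinearMap.det p.l0 := p.det_comp_symm
  rw [hdet, abs_of_pos (det_div_det_pos (p.det_segment_ne_zero h hn hσ)),
    integral_smul, smul_eq_mul]
  congr 1
  refine setIntegral_congr_fun hmeas fun x hx => ?_
  have hGx : G x ∈ S.cell (n + 1) σ := hcell ▸ mem_image_of_mem _ hx
  rw [p.transfer_back_eqOn h hn hσ hGx]
  simp [hG]

/-- The transfer of a finite element function to the next domain increases its squared norm at most
by the factor `1 + Δt α₂`. -/
theorem InVh.l2sq_transfer_le {v : E d → ℝ} (hv : S.InVh n v) (h : S.Admissible) (hn : n < S.N) :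
    l2sq (S.dom (n + 1)) (fun x => v (S.transfer (n + 1) n x)) ≤
      (1 + S.dt * S.alpha2 n) * l2sq (S.dom n) v := by
  have hcf := h.isCellFamily hn.le
  have hcf' := h.isCellFamily (n := n + 1) hn
  have := hcf.isFiniteMeasure_restrict
  have := hcf'.isFiniteMeasure_restrict
  have hi := ((hv.piecewiseContinuous.memLp_top hcf).mono_exponent
    (le_top (a := (2 : ℝ≥0∞)))).integrable_sq
  have hi' := (((hv.piecewiseContinuous_transfer h hn).memLp_top hcf').mono_exponent
    (le_top (a := (2 : ℝ≥0∞)))).integrable_sq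
  rw [l2sq, l2sq, dom_eq, dom_eq, hcf.setIntegral_eq_sum hi, hcf'.setIntegral_eq_sum hi',
    Finset.mul_sum]
  refine Finset.sum_le_sum fun σ hσ => ?_
  obtain ⟨p⟩ := h.nonempty_stepPieces hn hσ
  rw [p.setIntegral_transfer h hn hσ fun x => v x ^ 2]
  exact mul_le_mul_of_nonneg_right (p.det_div_det_le h hn hσ)
    (integral_nonneg fun x => sq_nonneg _)

end Scheme

/-! ### Discrete Gronwall inequality. -/

/-- A discrete Gronwall inequality with implicit terms. -/
theorem discrete_gronwall {a B p q F : ℕ → ℝ} {n : ℕ} (ha : ∀ i, 0 ≤ a i) (hB : ∀ i ≤ n, 0 ≤ B i)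
    (hp : ∀ i, 0 ≤ p i) (hF : ∀ i, 0 ≤ F i)
    (hg0 : ∀ i, 0 ≤ q i + p i) (hg : ∀ i ∈ Finset.Icc 1 n, q i + p i < 1)
    (hstep : ∀ i < n, a (i + 1) + B (i + 1) ≤ (1 + p i) * a i + q (i + 1) * a (i + 1) + F (i + 1)) :
    (1 + p n) * a n + ∑ i ∈ Finset.Icc 1 n, B i ≤
      ((1 + p 0) * a 0 + ∑ i ∈ Finset.Icc 1 n, F i) *
        Real.exp (∑ i ∈ Finset.Icc 1 n, (q i + p i) / (1 - (q i + p i))) := by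
  induction n with
  | zero => simp
  | succ k ih =>
    have hsub : Finset.Icc 1 k ⊆ Finset.Icc 1 (k + 1) := Finset.Icc_subset_Icc_right (by omega)
    specialize ih (fun i hi => hB i (by omega)) (fun i hi => hg i (hsub hi))
      (fun i hi => hstep i (by omega))
    simp only [Finset.sum_Icc_succ_top (Nat.le_add_left 1 k)]
    have hs := hstep k (by omega)
    have hgk : q (k + 1) + p (k + 1) < 1 := hg (k + 1) (by simp)
    have hBk : 0 ≤ ∑ i ∈ Finset.Icc 1 k, B i :=
      Finset.sum_nonneg fun i hi => hB i (by have := (Finset.mem_Icc.1 hi).2; omega)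
    have hB1 : 0 ≤ B (k + 1) := hB _ le_rfl
    set r := q (k + 1) + p (k + 1) with hr
    set C := (1 + p 0) * a 0 + ∑ i ∈ Finset.Icc 1 k, F i with hC
    set e := ∑ i ∈ Finset.Icc 1 k, (q i + p i) / (1 - (q i + p i)) with he
    set X := (1 + p (k + 1)) * a (k + 1) + (∑ i ∈ Finset.Icc 1 k, B i + B (k + 1)) with hX
    have he0 : 0 ≤ e := Finset.sum_nonneg fun i hi =>
      div_nonneg (hg0 i) (sub_nonneg.2 (hg i (hsub hi)).le)
    have haX : a (k + 1) ≤ X := by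
      have := mul_nonneg (hp (k + 1)) (ha (k + 1))
      rw [hX]
      linarith
    -- The implicit terms are absorbed into X itself; this leaves the factor 1 - r, which is
    -- positive by hypothesis.
    have hrX : r * a (k + 1) ≤ r * X := mul_le_mul_of_nonneg_left haX (hg0 (k + 1))
    have hX1 : (1 - r) * X ≤ C * Real.exp e + F (k + 1) := by
      have h1 : X ≤ C * Real.exp e + F (k + 1) + r * a (k + 1) := by
        have h2 : X = a (k + 1) + B (k + 1) + p (k + 1) * a (k + 1) +
          ∑ i ∈ Finset.Icc 1 k, B i := by rw [hX]; ring
        have h3 : r * a (k + 1) = q (k + 1) * a (k + 1) + p (k + 1) * a (k + 1) := by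
          rw [hr]; ring
        linarith
      linarith
    have hF1 : C * Real.exp e + F (k + 1) ≤ (C + F (k + 1)) * Real.exp e := by
      rw [add_mul]
      have := le_mul_of_one_le_right (hF (k + 1)) (Real.one_le_exp he0)
      linarith
    have hr1 : 0 < 1 - r := sub_pos.2 hgk
    -- Division by 1 - r is written as multiplication by 1 + r/(1 - r), which is at most exp(r/(1 -
    -- r)).
    have hXr : X = (1 - r) * X * (r / (1 - r) + 1) := by
      field_simp
      ring
    have hexp : r / (1 - r) + 1 ≤ Real.exp (r / (1 - r)) := Real.add_one_le_exp _
    have hfac : 0 ≤ r / (1 - r) + 1 :=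
      add_nonneg (div_nonneg (hg0 (k + 1)) hr1.le) zero_le_one
    have hCF : 0 ≤ (C + F (k + 1)) * Real.exp e := by
      refine mul_nonneg (add_nonneg (add_nonneg (mul_nonneg ?_ (ha 0)) ?_) (hF _))
        (Real.exp_pos _).le
      · linarith [hp 0]
      · exact Finset.sum_nonneg fun i _ => hF i
    calc X = (1 - r) * X * (r / (1 - r) + 1) := hXr
      _ ≤ (C + F (k + 1)) * Real.exp e * (r / (1 - r) + 1) :=
        mul_le_mul_of_nonneg_right (hX1.trans hF1) hfac
      _ ≤ (C + F (k + 1)) * Real.exp e * Real.exp (r / (1 - r)) :=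
        mul_le_mul_of_nonneg_left hexp hCF
      _ = (C + F (k + 1)) * Real.exp (e + r / (1 - r)) := by rw [Real.exp_add, mul_assoc]
      _ = _ := by rw [hC, add_assoc]

/-! ### Integrability tools and the stabilization estimate. -/

section MemLp

variable {α : Type*} [MeasurableSpace α] {ν : Measure α}

theorem memLp_two_of_top [IsFiniteMeasure ν] {g : α → ℝ} (hg : MemLp g ∞ ν) : MemLp g 2 ν :=
  hg.mono_exponent le_top

theorem memLp_top_mul {f g : α → ℝ} (hf : MemLp f ∞ ν) (hg : MemLp g ∞ ν) :
    MemLp (fun x => f x * g x) ∞ ν :=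
  MemLp.mul' hg hf

theorem memLp_top_inner {V : Type*} [NormedAddCommGroup V] [InnerProductSpace ℝ V] {F G : α → V}
    (hF : MemLp F ∞ ν) (hG : MemLp G ∞ ν) : MemLp (fun x => inner ℝ (F x) (G x)) ∞ ν := by
  refine (memLp_top_mul hF.norm hG.norm).of_le (hF.1.inner hG.1) (Eventually.of_forall fun x => ?_)
  rw [norm_mul, norm_norm, norm_norm]
  exact norm_inner_le_norm _ _

/-- The lower bound for the stabilization terms on one cell. -/
theorem stabilization_lower_bound {l Z r f : α → ℝ} {ε δ : ℝ} (hδ : 0 ≤ δ) (hl : MemLp l 2 ν)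
    (hZ : MemLp Z 2 ν) (hr : MemLp r 2 ν) (hf : MemLp f 2 ν) :
    δ / 4 * ∫ x, Z x ^ 2 ∂ν - δ * ε ^ 2 * ∫ x, l x ^ 2 ∂ν - δ * ∫ x, r x ^ 2 ∂ν -
        δ * ∫ x, f x ^ 2 ∂ν ≤
      δ * ∫ x, (-ε * l x + Z x + r x) * Z x ∂ν - δ * ∫ x, f x * Z x ∂ν := by
  have i1 : Integrable (fun x => (-ε * l x + Z x + r x) * Z x) ν :=
    (((hl.const_mul (-ε)).add hZ).add hr).integrable_mul hZ
  have i2 : Integrable (fun x => f x * Z x) ν := hf.integrable_mul hZ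
  have j1 := hZ.integrable_sq.const_mul (1 / 4)
  have j2 := hl.integrable_sq.const_mul (ε ^ 2)
  have key : 1 / 4 * ∫ x, Z x ^ 2 ∂ν - ε ^ 2 * ∫ x, l x ^ 2 ∂ν - ∫ x, r x ^ 2 ∂ν -
      ∫ x, f x ^ 2 ∂ν ≤ ∫ x, (-ε * l x + Z x + r x) * Z x ∂ν - ∫ x, f x * Z x ∂ν := by
    have j3 : Integrable (fun x => 1 / 4 * Z x ^ 2 - ε ^ 2 * l x ^ 2) ν := j1.sub j2
    have j4 : Integrable (fun x => 1 / 4 * Z x ^ 2 - ε ^ 2 * l x ^ 2 - r x ^ 2) ν :=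
      j3.sub hr.integrable_sq
    rw [← integral_const_mul, ← integral_const_mul, ← integral_sub j1 j2,
      ← integral_sub j3 hr.integrable_sq, ← integral_sub j4 hf.integrable_sq, ← integral_sub i1 i2]
    refine integral_mono (j4.sub hf.integrable_sq) (i1.sub i2) fun x => ?_
    simp only
    -- Each of the three cross terms costs a quarter of Z², so a quarter of it remains.
    nlinarith [sq_nonneg (ε * l x - Z x / 2), sq_nonneg (r x + Z x / 2),
      sq_nonneg (f x - Z x / 2)]
  have := mul_le_mul_of_nonneg_left key hδ
  linarith

end MemLp

theorem piecewiseContinuous_of_lipschitzOnWith {ι : Type*} {d : ℕ} {s : Finset ι}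
    {K : ι → Set (E d)} {F : E d → E d} {C : ℝ≥0}
    (hF : LipschitzOnWith C F (interior (⋃ i ∈ s, K i))) : PiecewiseContinuous s K F := by
  obtain ⟨G, hG, hFG⟩ := hF.extend_finite_dimension
  exact fun i hi => ⟨G, hG.continuous,
    hFG.mono (interior_mono (subset_biUnion_of_mem (u := K) hi))⟩

theorem ae_differentiableAt_of_lipschitzOnWith {d : ℕ} {F : E d → E d} {C : ℝ≥0}
    {U : Set (E d)} (hU : IsOpen U) (hF : LipschitzOnWith C F U) :
    ∀ᵐ x ∂(volume.restrict U), DifferentiableAt ℝ F x := by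
  filter_upwards [hF.ae_differentiableWithinAt (μ := volume) hU.measurableSet,
    ae_restrict_mem hU.measurableSet] with x hx hxU
  exact hx.differentiableAt (hU.mem_nhds hxU)

/-- The derivative is bounded by the Lipschitz constant. A global Lipschitz extension, equal to F on
the open set U, supplies measurability. -/
theorem memLp_top_divergence_of_lipschitzOnWith {d : ℕ} {F : E d → E d} {C : ℝ≥0}
    {U : Set (E d)} (hU : IsOpen U) [IsFiniteMeasure (volume.restrict U)]
    (hF : LipschitzOnWith C F U) : MemLp (divergence F) ∞ (volume.restrict U) := by
  obtain ⟨G, hG, hFG⟩ := hF.extend_finite_dimension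
  set L := lipschitzExtensionConstant (E d) * C
  have hmeas : Measurable (divergence G) := by
    refine Finset.measurable_sum _ fun i _ => ?_
    exact (EuclideanSpace.proj (𝕜 := ℝ) i).continuous.measurable.comp
      (measurable_fderiv_apply_const ℝ G _)
  have hb : ∀ x, ‖divergence G x‖ ≤ ∑ _i : Fin d, (L : ℝ) := fun x => by
    refine norm_sum_le_of_le _ fun i _ => ?_
    refine (PiLp.norm_apply_le _ i).trans ((ContinuousLinearMap.le_opNorm _ _).trans ?_)
    simpa using norm_fderiv_le_of_lipschitz ℝ hG (x₀ := x)
  refine (MemLp.of_bound hmeas.aestronglyMeasurable _ (Eventually.of_forall hb)).ae_eq ?_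
  filter_upwards [ae_restrict_mem hU.measurableSet] with x hx
  exact (divergence_congr (Filter.mem_of_superset (hU.mem_nhds hx) hFG)).symm

/-! ### Energy estimate for one time step. -/

namespace Scheme

variable {d : ℕ} {S : Scheme d} {n : ℕ} {σ : Finset (E d)}

theorem InVh.exists_lipschitzWith_indicator {v : E d → ℝ} (hv : S.InVh n v) (h : S.Admissible)
    (hn : n ≤ S.N) :
    ∃ C : ℝ≥0, LipschitzWith C ((⋃ σ ∈ S.mesh.cells, S.cell n σ).indicator v) :=
  ALESUPG.exists_lipschitzWith_indicator (h.isCellFamily hn).isCompact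
    (closedDom_eq S n ▸ hv.2.1) fun _ hσ => hv.exists_lipschitzOnWith h hn hσ

theorem Admissible.integral_relVel_eq_zero (h : S.Admissible) (hn : n < S.N) {v : E d → ℝ}
    (hv : S.InVh (n + 1) v) {C : ℝ≥0}
    (hb : LipschitzOnWith C (S.b (S.time (n + 1))) (S.dom (n + 1))) :
    ∫ x in S.dom (n + 1), (2 * (inner ℝ (S.relVel (n + 1) x) (gradient v x) * v x) +
      (divergence (S.b (S.time (n + 1))) x - divergence (S.w (n + 1)) x) * v x ^ 2) = 0 := by
  have hcf := h.isCellFamily (n := n + 1) hn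
  have hbd := ae_differentiableAt_of_lipschitzOnWith isOpen_interior hb
  have hwd := h.ae_differentiableAt_w hn
  obtain ⟨G, hG, hbG⟩ := hb.extend_finite_dimension
  have hprod : ∀ j, ∃ C : ℝ≥0, LipschitzWith C ((⋃ σ ∈ S.mesh.cells, S.cell (n + 1) σ).indicator
      fun x => v x ^ 2 * S.relVel (n + 1) x j) := by
    intro j
    have hpj : LipschitzWith 1 fun z : E d => z j := LipschitzWith.of_dist_le_mul fun x y => by
      simpa [dist_eq_norm] using PiLp.norm_apply_le (x - y) j
    -- The field b is controlled only on the open domain, so it is replaced by its Lipschitz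
    -- extension; on the boundary the factor v² vanishes.
    have heq : (⋃ σ ∈ S.mesh.cells, S.cell (n + 1) σ).indicator
        (fun x => v x ^ 2 * S.relVel (n + 1) x j) =
        (⋃ σ ∈ S.mesh.cells, S.cell (n + 1) σ).indicator
          fun x => v x * v x * (G x j - S.w (n + 1) x j) := by
      refine indicator_congr fun x hx => ?_
      rw [← closedDom_eq] at hx
      by_cases hxi : x ∈ S.dom (n + 1)
      · simp [relVel, hbG hxi, sq]
      · have : v x = 0 := hv.2.1 x ⟨subset_closure hx, hxi⟩
        simp [this]
    rw [heq]
    refine ALESUPG.exists_lipschitzWith_indicator hcf.isCompact (fun x hx => ?_) fun σ hσ => ?_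
    · rw [← closedDom_eq] at hx
      simp [hv.2.1 x hx]
    · have hvL := hv.exists_lipschitzOnWith h hn hσ
      have hK := hcf.isCompact σ hσ
      refine LipschitzOnWith.exists_mul_of_isCompact hK
        (LipschitzOnWith.exists_mul_of_isCompact hK hvL hvL) ?_
      obtain ⟨W, hW⟩ := h.exists_w_eqOn hn hσ
      have hWL : LipschitzWith ‖LinearMap.toContinuousLinearMap W.linear‖₊ W :=
        lipschitzWith_of_nnnorm_fderiv_le
          (fun x => (AffineMap.hasFDerivAt_toContinuousLinearMap W x).differentiableAt)
          fun x => by rw [(AffineMap.hasFDerivAt_toContinuousLinearMap W x).fderiv]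
      have hdL := (hpj.comp hG).sub (hpj.comp hWL)
      refine Exists.intro _ fun x hx y hy => le_trans (le_of_eq ?_) (hdL x y)
      simp only [hW hx, hW hy, Function.comp_apply]
  have hdiff : ∀ᵐ x ∂(volume.restrict (interior (⋃ σ ∈ S.mesh.cells, S.cell (n + 1) σ))),
      DifferentiableAt ℝ (S.relVel (n + 1)) x := by
    rw [← dom_eq]
    filter_upwards [hbd, hwd] with x h1 h2
    exact h1.sub h2
  have := integral_divergence_sq_mul_eq_zero hcf (hv.exists_lipschitzWith_indicator h hn) hdiff hprod
  rw [← dom_eq] at this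
  rw [← this]
  refine integral_congr_ae ?_
  filter_upwards [hbd, hwd] with x h1 h2
  congr 2
  rw [divergence, divergence, divergence, ← Finset.sum_sub_distrib]
  have : fderiv ℝ (S.relVel (n + 1)) x =
      fderiv ℝ (S.b (S.time (n + 1))) x - fderiv ℝ (S.w (n + 1)) x :=
    fderiv_sub h1 h2
  simp [this]

/-- The stabilization terms on one cell, tested with the solution, under the bounds on `δ`. -/
theorem stabilization_cell_lower_bound (h : S.Admissible) (heps : 0 < S.eps) {μ cinv : ℝ}
    (hn : n ≤ S.N) (hcinv : 0 < cinv) (hσ : σ ∈ S.mesh.cells) {u : E d → ℝ}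
    (hinv : Real.sqrt (l2sq (S.cell n σ) (Laplacian.laplacian u)) ≤
      cinv * (Metric.diam (S.cell n σ))⁻¹ * Real.sqrt (∫ x in S.cell n σ, ‖gradient u x‖ ^ 2))
    (hδ0 : 0 ≤ S.δ n σ)
    (hδc : S.δ n σ * (2 * (linfty (S.cell n σ) (S.c (S.time n))).toReal ^ 2) ≤ μ)
    (hδh : S.δ n σ ≤ Metric.diam (S.cell n σ) ^ 2 / (2 * S.eps * cinv ^ 2))
    (hδt : S.δ n σ ≤ S.dt / 4)
    (hu : MemLp u ∞ (volume.restrict (S.dom n)))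
    (hl : MemLp (Laplacian.laplacian u) ∞ (volume.restrict (S.dom n)))
    (hZ : MemLp (fun x => inner ℝ (S.relVel n x) (gradient u x)) ∞ (volume.restrict (S.dom n)))
    (hc : MemLp (S.c (S.time n)) ∞ (volume.restrict (S.dom n)))
    (hf : MemLp (S.f (S.time n)) 2 (volume.restrict (S.dom n))) :
    S.δ n σ / 4 * l2sq (S.cell n σ) (fun x => inner ℝ (S.relVel n x) (gradient u x)) -
        S.eps / 2 * (∫ x in S.cell n σ, ‖gradient u x‖ ^ 2) - μ / 2 * l2sq (S.cell n σ) u -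
        S.dt / 4 * l2sq (S.cell n σ) (S.f (S.time n)) ≤
      S.δ n σ * (∫ x in S.cell n σ,
        (-S.eps * Laplacian.laplacian u x + inner ℝ (S.relVel n x) (gradient u x) +
          S.c (S.time n) x * u x) * inner ℝ (S.relVel n x) (gradient u x)) -
      S.δ n σ * ∫ x in S.cell n σ,
        S.f (S.time n) x * inner ℝ (S.relVel n x) (gradient u x) := by
  have hcf := h.isCellFamily hn
  have hle : volume.restrict (S.cell n σ) ≤ volume.restrict (S.dom n) := by
    rw [dom_eq]
    exact hcf.restrict_cell_le hσ
  have : IsFiniteMeasure (volume.restrict (S.cell n σ)) :=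
    isFiniteMeasure_restrict.2 (hcf.isCompact σ hσ).measure_lt_top.ne
  have hcK := hc.mono_measure hle
  have huK := hu.mono_measure hle
  have hcu : MemLp (fun x => S.c (S.time n) x * u x) ∞ (volume.restrict (S.cell n σ)) :=
    memLp_top_mul hcK huK
  have key := stabilization_lower_bound (ε := S.eps) hδ0 (memLp_two_of_top (hl.mono_measure hle))
    (memLp_two_of_top (hZ.mono_measure hle)) (memLp_two_of_top hcu) (hf.mono_measure hle)
  refine le_trans ?_ key
  have hG0 : 0 ≤ ∫ x in S.cell n σ, ‖gradient u x‖ ^ 2 := integral_nonneg fun x => sq_nonneg _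
  have hl0 : 0 ≤ l2sq (S.cell n σ) (Laplacian.laplacian u) := integral_nonneg fun x => sq_nonneg _
  have hu0 : 0 ≤ l2sq (S.cell n σ) u := integral_nonneg fun x => sq_nonneg _
  have hf0 : 0 ≤ l2sq (S.cell n σ) (S.f (S.time n)) := integral_nonneg fun x => sq_nonneg _
  have h1 : S.δ n σ * S.eps ^ 2 * l2sq (S.cell n σ) (Laplacian.laplacian u) ≤
      S.eps / 2 * ∫ x in S.cell n σ, ‖gradient u x‖ ^ 2 := by
    set D := Metric.diam (S.cell n σ)
    set G := ∫ x in S.cell n σ, ‖gradient u x‖ ^ 2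
    have hsq : l2sq (S.cell n σ) (Laplacian.laplacian u) ≤ cinv ^ 2 * (D⁻¹) ^ 2 * G := by
      have := pow_le_pow_left₀ (Real.sqrt_nonneg _) hinv 2
      rwa [Real.sq_sqrt hl0, mul_pow, mul_pow, Real.sq_sqrt hG0] at this
    -- Only an inequality is used, so a zero diameter, whose inverse is zero here, need not be
    -- excluded.
    have hDD : D ^ 2 * (D⁻¹) ^ 2 ≤ 1 := by
      rw [← mul_pow]
      rcases eq_or_ne D 0 with h0 | h0
      · simp [h0]
      · simp [mul_inv_cancel₀ h0]
    calc S.δ n σ * S.eps ^ 2 * l2sq (S.cell n σ) (Laplacian.laplacian u)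
        ≤ D ^ 2 / (2 * S.eps * cinv ^ 2) * S.eps ^ 2 * (cinv ^ 2 * (D⁻¹) ^ 2 * G) := by
          gcongr
      _ = S.eps / 2 * G * (D ^ 2 * (D⁻¹) ^ 2) := by
          generalize D⁻¹ = R
          field_simp
      _ ≤ S.eps / 2 * G * 1 := by gcongr
      _ = S.eps / 2 * G := mul_one _
  have h2 : S.δ n σ * (∫ x in S.cell n σ, (S.c (S.time n) x * u x) ^ 2) ≤
      μ / 2 * l2sq (S.cell n σ) u := by
    set C := (linfty (S.cell n σ) (S.c (S.time n))).toReal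
    have hmono : (∫ x in S.cell n σ, (S.c (S.time n) x * u x) ^ 2) ≤
        C ^ 2 * l2sq (S.cell n σ) u := by
      rw [l2sq, ← integral_const_mul]
      refine integral_mono_ae (memLp_two_of_top hcu).integrable_sq
        ((memLp_two_of_top huK).integrable_sq.const_mul _) ?_
      filter_upwards [enorm_ae_le_eLpNormEssSup (S.c (S.time n))
        (volume.restrict (S.cell n σ))] with x hx
      have hxC : |S.c (S.time n) x| ≤ C := by
        rw [← Real.norm_eq_abs, ← toReal_enorm]
        exact ENNReal.toReal_mono hcK.eLpNorm_ne_top (by rwa [linfty, eLpNorm_exponent_top])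
      rw [mul_pow]
      exact mul_le_mul_of_nonneg_right (sq_le_sq' (abs_le.1 hxC).1 (abs_le.1 hxC).2) (sq_nonneg _)
    have := mul_le_mul_of_nonneg_left hmono hδ0
    have := mul_le_mul_of_nonneg_right hδc hu0
    linarith
  have h3 := mul_le_mul_of_nonneg_right hδt hf0
  simp only [l2sq] at *
  linarith

theorem supgNormSq_nonneg {μ : ℝ} (hμ : 0 ≤ μ) (heps : 0 ≤ S.eps)
    (hδ : ∀ σ ∈ S.mesh.cells, 0 ≤ S.δ n σ) (v : E d → ℝ) : 0 ≤ S.supgNormSq μ n v := by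
  refine add_nonneg (add_nonneg (mul_nonneg heps (integral_nonneg fun x => sq_nonneg _))
    (Finset.sum_nonneg fun σ hσ => mul_nonneg (hδ σ hσ) (integral_nonneg fun x => sq_nonneg _)))
    (mul_nonneg hμ (integral_nonneg fun x => sq_nonneg _))

/-- The energy estimate for one time step. -/
theorem IsSolution.energy_step {u : ℕ → E d → ℝ} (hu : S.IsSolution u) (h : S.Admissible)
    (heps : 0 < S.eps) (hn : n < S.N)
    (hb : ∃ L : ℝ≥0, LipschitzOnWith L (S.b (S.time (n + 1))) (S.dom (n + 1)))
    (hc : MemLp (S.c (S.time (n + 1))) ∞ (volume.restrict (S.dom (n + 1))))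
    (hf : MemLp (S.f (S.time (n + 1))) 2 (volume.restrict (S.dom (n + 1))))
    {μ : ℝ} (hμ : 0 < μ)
    (hpos : ∀ᵐ x ∂(volume.restrict (S.dom (n + 1))),
      μ ≤ S.c (S.time (n + 1)) x - 1 / 2 * divergence (S.b (S.time (n + 1))) x)
    {cinv : ℝ} (hcinv : S.IsInverseConst cinv)
    (hδ0 : ∀ σ ∈ S.mesh.cells, 0 ≤ S.δ (n + 1) σ)
    (hδc : ∀ σ ∈ S.mesh.cells,
      S.δ (n + 1) σ * (2 * (linfty (S.cell (n + 1) σ) (S.c (S.time (n + 1)))).toReal ^ 2) ≤ μ)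
    (hδh : ∀ σ ∈ S.mesh.cells,
      S.δ (n + 1) σ ≤ Metric.diam (S.cell (n + 1) σ) ^ 2 / (2 * S.eps * cinv ^ 2))
    (hδt : ∀ σ ∈ S.mesh.cells, S.δ (n + 1) σ ≤ S.dt / 4) :
    l2sq (S.dom (n + 1)) (u (n + 1)) + S.dt / 2 * S.supgNormSq μ (n + 1) (u (n + 1)) ≤
      (1 + S.dt * S.alpha2 n) * l2sq (S.dom n) (u n) +
        S.dt * S.alpha1 (n + 1) * l2sq (S.dom (n + 1)) (u (n + 1)) +
        S.dt * ((2 / μ + S.dt / 2) * l2sq (S.dom (n + 1)) (S.f (S.time (n + 1)))) := by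
  have hdt := h.dt_pos
  obtain ⟨L, hb⟩ := hb
  have hN : n + 1 ≤ S.N := hn
  have hcf := h.isCellFamily hN
  have hV := hu.1 (n + 1) hN
  have hV0 := hu.1 n hn.le
  have heq := hu.2 n hn (u (n + 1)) hV
  have hibp := h.integral_relVel_eq_zero hn hV hb
  set Ω := S.dom (n + 1) with hΩ
  have hΩ' : Ω = interior (⋃ σ ∈ S.mesh.cells, S.cell (n + 1) σ) := dom_eq S (n + 1)
  have hfin : IsFiniteMeasure (volume.restrict Ω) := hΩ' ▸ hcf.isFiniteMeasure_restrict
  have hΩo : IsOpen Ω := isOpen_interior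
  set v := u (n + 1) with hv
  set vold : E d → ℝ := fun x => u n (S.transfer (n + 1) n x) with hvold
  set Z : E d → ℝ := fun x => inner ℝ (S.relVel (n + 1) x) (gradient v x) with hZdef
  set b := S.b (S.time (n + 1)) with hbdef
  set c := S.c (S.time (n + 1)) with hcdef
  set f := S.f (S.time (n + 1)) with hfdef
  set w := S.w (n + 1) with hwdef
  have mv : MemLp v ∞ (volume.restrict Ω) := hΩ' ▸ hV.piecewiseContinuous.memLp_top hcf
  have mvold : MemLp vold ∞ (volume.restrict Ω) :=
    hΩ' ▸ (hV0.piecewiseContinuous_transfer h hn).memLp_top hcf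
  have mg : MemLp (gradient v) ∞ (volume.restrict Ω) :=
    hΩ' ▸ hV.piecewiseContinuous_gradient.memLp_top hcf
  have ml : MemLp (Laplacian.laplacian v) ∞ (volume.restrict Ω) :=
    hΩ' ▸ hV.piecewiseContinuous_laplacian.memLp_top hcf
  have mw : MemLp w ∞ (volume.restrict Ω) := hΩ' ▸ (h.piecewiseContinuous_w hn).memLp_top hcf
  have mdw : MemLp (divergence w) ∞ (volume.restrict Ω) :=
    hΩ' ▸ (h.piecewiseContinuous_divergence_w hn).memLp_top hcf
  have mb : MemLp b ∞ (volume.restrict Ω) :=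
    hΩ' ▸ (piecewiseContinuous_of_lipschitzOnWith (hΩ' ▸ hb)).memLp_top hcf
  have mdb : MemLp (divergence b) ∞ (volume.restrict Ω) :=
    memLp_top_divergence_of_lipschitzOnWith hΩo hb
  have mZ : MemLp Z ∞ (volume.restrict Ω) := memLp_top_inner (mb.sub mw) mg
  have mvv : MemLp (fun x => v x ^ 2) ∞ (volume.restrict Ω) := by
    simpa only [sq] using memLp_top_mul mv mv
  have iv : IntegrableOn (fun x => v x ^ 2) Ω := mvv.integrable le_top
  have ivold : IntegrableOn (fun x => vold x ^ 2) Ω := (memLp_two_of_top mvold).integrable_sq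
  have ifs : IntegrableOn (fun x => f x ^ 2) Ω := hf.integrable_sq
  have ig : IntegrableOn (fun x => ‖gradient v x‖ ^ 2) Ω := by
    simpa only [sq, IntegrableOn] using (memLp_top_mul mg.norm mg.norm).integrable le_top
  -- the discrete time derivative
  have hA : (l2sq Ω v - l2sq Ω vold) / (2 * S.dt) ≤
      ∫ x in Ω, (v x - vold x) / S.dt * v x := by
    rw [l2sq, l2sq, ← integral_sub iv ivold, ← integral_div]
    refine integral_mono ((iv.sub ivold).div_const _) ?_ fun x => ?_
    · have : MemLp (fun x => (v x - vold x) / S.dt) ∞ (volume.restrict Ω) := by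
        simpa only [div_eq_mul_inv, Pi.sub_apply] using (mv.sub mvold).mul_const (S.dt⁻¹)
      exact (memLp_top_mul this mv).integrable le_top
    · simp only
      rw [div_mul_eq_mul_div, div_le_div_iff₀ (by positivity) hdt]
      -- The pointwise excess is a positive multiple of (v - vold)².
      nlinarith [mul_nonneg hdt.le (sq_nonneg (v x - vold x))]
  -- convection and reaction
  have hB : (μ - S.alpha1 (n + 1) / 2) * l2sq Ω v ≤
      (∫ x in Ω, inner ℝ (b x) (gradient v x) * v x) + (∫ x in Ω, c x * v x * v x) -
        ∫ x in Ω, inner ℝ (w x) (gradient v x) * v x := by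
    have i1 := (memLp_top_mul (memLp_top_inner mb mg) mv).integrable le_top
    have i2 := (memLp_top_mul (memLp_top_mul hc mv) mv).integrable le_top
    have i3 := (memLp_top_mul (memLp_top_inner mw mg) mv).integrable le_top
    have i4 : Integrable (fun x => 2 * (Z x * v x) + (divergence b x - divergence w x) * v x ^ 2)
        (volume.restrict Ω) :=
      (((memLp_top_mul mZ mv).integrable le_top).const_mul 2).add
        ((memLp_top_mul (mdb.sub mdw) mvv).integrable le_top)
    have i5 : Integrable (fun x => inner ℝ (b x) (gradient v x) * v x + c x * v x * v x)
        (volume.restrict Ω) := i1.add i2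
    have i6 : Integrable (fun x => inner ℝ (b x) (gradient v x) * v x + c x * v x * v x -
        inner ℝ (w x) (gradient v x) * v x) (volume.restrict Ω) := i5.sub i3
    rw [← integral_add i1 i2, ← integral_sub i5 i3]
    -- Half of the vanishing integral is subtracted, which trades the convection terms for -(∇·b -
    -- ∇·w)v²/2.
    have hsub := integral_sub i6 (i4.const_mul (1 / 2))
    rw [integral_const_mul, hibp, mul_zero, sub_zero] at hsub
    rw [← hsub, l2sq, ← integral_const_mul]
    refine integral_mono_ae (iv.const_mul _) (i6.sub (i4.const_mul (1 / 2))) ?_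
    filter_upwards [hpos, h.ae_abs_divergence_w_le hn] with x h1 h2
    have hZx : Z x = inner ℝ (b x) (gradient v x) - inner ℝ (w x) (gradient v x) :=
      inner_sub_left _ _ _
    have h3 := (abs_le.1 h2).1
    have h4 : (μ - S.alpha1 (n + 1) / 2) * v x ^ 2 ≤
        (c x - 1 / 2 * divergence b x + 1 / 2 * divergence w x) * v x ^ 2 :=
      mul_le_mul_of_nonneg_right (by linarith) (sq_nonneg _)
    rw [hZx]
    linarith
  -- the source term
  have hC : (∫ x in Ω, f x * v x) ≤ 1 / μ * l2sq Ω f + μ / 4 * l2sq Ω v := by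
    rw [l2sq, l2sq, ← integral_const_mul, ← integral_const_mul,
      ← integral_add (ifs.const_mul _) (iv.const_mul _)]
    refine integral_mono (hf.integrable_mul (memLp_two_of_top mv))
      ((ifs.const_mul _).add (iv.const_mul _)) fun x => ?_
    have hsq : 0 ≤ (f x - μ / 2 * v x) ^ 2 / μ := by positivity
    have hexp : (f x - μ / 2 * v x) ^ 2 / μ =
        1 / μ * f x ^ 2 + μ / 4 * v x ^ 2 - f x * v x := by
      field_simp
      ring
    simp only
    linarith
  -- the stabilization terms
  have hD : (1 / 4 * ∑ σ ∈ S.mesh.cells, S.δ (n + 1) σ * l2sq (S.cell (n + 1) σ) Z) -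
        S.eps / 2 * (∫ x in Ω, ‖gradient v x‖ ^ 2) - μ / 2 * l2sq Ω v - S.dt / 4 * l2sq Ω f ≤
      (∑ σ ∈ S.mesh.cells, S.δ (n + 1) σ * ∫ x in S.cell (n + 1) σ,
        (-S.eps * Laplacian.laplacian v x + Z x + c x * v x) * Z x) -
      ∑ σ ∈ S.mesh.cells, S.δ (n + 1) σ * ∫ x in S.cell (n + 1) σ, f x * Z x := by
    have e1 : l2sq Ω v = ∑ σ ∈ S.mesh.cells, l2sq (S.cell (n + 1) σ) v := by
      rw [l2sq, hΩ']
      exact hcf.setIntegral_eq_sum (hΩ' ▸ iv)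
    have e2 : l2sq Ω f = ∑ σ ∈ S.mesh.cells, l2sq (S.cell (n + 1) σ) f := by
      rw [l2sq, hΩ']
      exact hcf.setIntegral_eq_sum (hΩ' ▸ ifs)
    have e3 : (∫ x in Ω, ‖gradient v x‖ ^ 2) =
        ∑ σ ∈ S.mesh.cells, ∫ x in S.cell (n + 1) σ, ‖gradient v x‖ ^ 2 := by
      rw [hΩ']
      exact hcf.setIntegral_eq_sum (hΩ' ▸ ig)
    rw [e1, e2, e3, Finset.mul_sum, Finset.mul_sum, Finset.mul_sum, Finset.mul_sum,
      ← Finset.sum_sub_distrib, ← Finset.sum_sub_distrib, ← Finset.sum_sub_distrib,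
      ← Finset.sum_sub_distrib]
    refine Finset.sum_le_sum fun σ hσ => ?_
    have := stabilization_cell_lower_bound h heps hN hcinv.1 hσ
      (hcinv.2 (n + 1) (Finset.mem_Icc.2 ⟨by omega, hN⟩) σ hσ v hV) (hδ0 σ hσ) (hδc σ hσ)
      (hδh σ hσ) (hδt σ hσ) mv ml mZ hc hf
    refine le_trans (le_of_eq ?_) this
    ring
  have hT : l2sq Ω vold ≤ (1 + S.dt * S.alpha2 n) * l2sq (S.dom n) (u n) :=
    hV0.l2sq_transfer_le h hn
  have hG : (∫ x in Ω, inner ℝ (gradient v x) (gradient v x)) = ∫ x in Ω, ‖gradient v x‖ ^ 2 := by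
    simp only [real_inner_self_eq_norm_sq]
  have hG0 : 0 ≤ S.eps * ∫ x in Ω, ‖gradient v x‖ ^ 2 :=
    mul_nonneg heps.le (integral_nonneg fun x => sq_nonneg _)
  simp only [aSUPG] at heq
  rw [← hΩ, ← hbdef, ← hcdef, hG] at heq
  simp only [supgNormSq]
  rw [← hΩ]
  set U := l2sq Ω v
  set Uo := l2sq Ω vold
  set F := l2sq Ω f
  set G := ∫ x in Ω, ‖gradient v x‖ ^ 2
  set D := ∑ σ ∈ S.mesh.cells, S.δ (n + 1) σ * l2sq (S.cell (n + 1) σ) Z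
  -- Of the coefficients, diffusion keeps 1/2, of which 1/4 is used; the δ-terms keep 1/4; the
  -- μ-term keeps 1 - 1/4 - 1/2 = 1/4 after the source and reaction estimates.
  have hmain : (U - Uo) / (2 * S.dt) + (S.eps * G + D + μ * U) / 4 - S.alpha1 (n + 1) / 2 * U ≤
      (1 / μ + S.dt / 4) * F := by
    linarith
  have hmul := mul_le_mul_of_nonneg_left hmain (by positivity : (0 : ℝ) ≤ 2 * S.dt)
  have hcancel : 2 * S.dt * ((U - Uo) / (2 * S.dt)) = U - Uo := by
    field_simp
  have hrhs : 2 * S.dt * ((1 / μ + S.dt / 4) * F) = S.dt * ((2 / μ + S.dt / 2) * F) := by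
    field_simp
    ring
  rw [hrhs, mul_sub, mul_add, hcancel] at hmul
  linarith

end Scheme

end ALESUPG

/-! ### Summation over the time steps. -/

theorem mainTheorem1 {d : ℕ} (hd : d = 2 ∨ d = 3) (S : ALESUPG.Scheme d)
    (hT : 0 < S.T) (hN : 0 < S.N) (heps : 0 < S.eps)
    -- the ALE mappings are piecewise affine, and bijective onto the domains at all times
    (hA : ∀ n ≤ S.N, S.mesh.IsP1Map (S.A (S.time n)))
    (hAinj : ∀ n < S.N, ∀ t ∈ Set.Icc (S.time n) (S.time (n + 1)),
      Set.InjOn (S.interp n t) S.mesh.region)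
    -- regularity of the coefficients and of the source term
    (hb : ∀ n ∈ Finset.Icc 1 S.N, ∃ L : NNReal, LipschitzOnWith L (S.b (S.time n)) (S.dom n))
    (hc : ∀ n ∈ Finset.Icc 1 S.N,
      MeasureTheory.MemLp (S.c (S.time n)) ⊤ (MeasureTheory.volume.restrict (S.dom n)))
    (hf : ∀ n ∈ Finset.Icc 1 S.N,
      MeasureTheory.MemLp (S.f (S.time n)) 2 (MeasureTheory.volume.restrict (S.dom n)))
    -- `c - ∇ · b / 2 ≥ μ > 0`
    (μ : ℝ) (hμ : 0 < μ)
    (hpos : ∀ n ∈ Finset.Icc 1 S.N, ∀ᵐ x ∂(MeasureTheory.volume.restrict (S.dom n)),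
      μ ≤ S.c (S.time n) x - 1 / 2 * ALESUPG.divergence (S.b (S.time n)) x)
    -- the bounds on the stabilization parameters, free of division by zero
    (cinv : ℝ) (hcinv : S.IsInverseConst cinv)
    (hδ0 : ∀ n ∈ Finset.Icc 1 S.N, ∀ σ ∈ S.mesh.cells, 0 ≤ S.δ n σ)
    (hδc : ∀ n ∈ Finset.Icc 1 S.N, ∀ σ ∈ S.mesh.cells,
      S.δ n σ * (2 * (ALESUPG.linfty (S.cell n σ) (S.c (S.time n))).toReal ^ 2) ≤ μ)
    (hδh : ∀ n ∈ Finset.Icc 1 S.N, ∀ σ ∈ S.mesh.cells,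
      S.δ n σ ≤ Metric.diam (S.cell n σ) ^ 2 / (2 * S.eps * cinv ^ 2))
    (hδt : ∀ n ∈ Finset.Icc 1 S.N, ∀ σ ∈ S.mesh.cells, S.δ n σ ≤ S.dt / 4)
    (u : ℕ → ALESUPG.E d → ℝ) (hu : S.IsSolution u)
    (n : ℕ) (hn : n < S.N)
    (hdt : ∀ i ∈ Finset.Icc 1 (n + 1), S.dt * (S.alpha1 i + S.alpha2 i) < 1) :
    ALESUPG.l2sq (S.dom (n + 1)) (u (n + 1)) +
        S.dt / 2 * ∑ i ∈ Finset.Icc 1 (n + 1), S.supgNormSq μ i (u i) ≤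
      ((1 + S.dt * S.alpha2 0) * ALESUPG.l2sq (S.dom 0) (u 0) +
          S.dt * ∑ i ∈ Finset.Icc 1 (n + 1),
            (2 / μ + S.dt / 2) * ALESUPG.l2sq (S.dom i) (S.f (S.time i))) *
        Real.exp (S.dt * ∑ i ∈ Finset.Icc 1 (n + 1),
          (S.alpha1 i + S.alpha2 i) / (1 - S.dt * (S.alpha1 i + S.alpha2 i))) := by
  have h : S.Admissible := ⟨hT, hN, hA, hAinj⟩
  have hdt0 := h.dt_pos
  have hmem : ∀ i ≤ n, i + 1 ∈ Finset.Icc 1 S.N := fun i hi => Finset.mem_Icc.2 ⟨by omega, by omega⟩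
  have hl2 : ∀ (s : Set (ALESUPG.E d)) g, 0 ≤ ALESUPG.l2sq s g := fun s g =>
    integral_nonneg fun x => sq_nonneg _
  have hfac : 0 ≤ 2 / μ + S.dt / 2 := by positivity
  have key := ALESUPG.discrete_gronwall (n := n + 1)
    (a := fun i => ALESUPG.l2sq (S.dom i) (u i))
    -- At level 0 neither the mesh velocity nor the sign of δ is prescribed, so that term, absent
    -- from the sum, is set to zero.
    (B := fun i => if i = 0 then 0 else S.dt / 2 * S.supgNormSq μ i (u i))
    (p := fun i => S.dt * S.alpha2 i) (q := fun i => S.dt * S.alpha1 i)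
    (F := fun i => S.dt * ((2 / μ + S.dt / 2) * ALESUPG.l2sq (S.dom i) (S.f (S.time i))))
    (fun i => hl2 _ _)
    (fun i hi => by
      split_ifs with h0
      · exact le_rfl
      · have hi' : i ∈ Finset.Icc 1 S.N := Finset.mem_Icc.2 ⟨by omega, by omega⟩
        exact mul_nonneg (by positivity)
          (ALESUPG.Scheme.supgNormSq_nonneg hμ.le heps.le (hδ0 i hi') _))
    (fun i => mul_nonneg hdt0.le (S.alpha2_nonneg i))
    (fun i => mul_nonneg hdt0.le (mul_nonneg hfac (hl2 _ _)))
    (fun i => add_nonneg (mul_nonneg hdt0.le (S.alpha1_nonneg i))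
      (mul_nonneg hdt0.le (S.alpha2_nonneg i)))
    (fun i hi => by simpa only [mul_add] using hdt i hi)
    (fun i hi => by
      have hi' := hmem i (by omega)
      rw [if_neg (Nat.succ_ne_zero i)]
      exact hu.energy_step h heps (by omega) (hb _ hi') (hc _ hi') (hf _ hi') hμ (hpos _ hi') hcinv
        (hδ0 _ hi') (hδc _ hi') (hδh _ hi') (hδt _ hi'))
  have hBsum : ∑ i ∈ Finset.Icc 1 (n + 1),
      (if i = 0 then 0 else S.dt / 2 * S.supgNormSq μ i (u i)) =
      S.dt / 2 * ∑ i ∈ Finset.Icc 1 (n + 1), S.supgNormSq μ i (u i) := by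
    rw [Finset.mul_sum]
    refine Finset.sum_congr rfl fun i hi => if_neg ?_
    have := (Finset.mem_Icc.1 hi).1
    omega
  have hesum : ∑ i ∈ Finset.Icc 1 (n + 1), (S.dt * S.alpha1 i + S.dt * S.alpha2 i) /
        (1 - (S.dt * S.alpha1 i + S.dt * S.alpha2 i)) =
      S.dt * ∑ i ∈ Finset.Icc 1 (n + 1),
        (S.alpha1 i + S.alpha2 i) / (1 - S.dt * (S.alpha1 i + S.alpha2 i)) := by
    rw [Finset.mul_sum]
    refine Finset.sum_congr rfl fun i _ => ?_
    rw [← mul_add, mul_div_assoc]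
  rw [hBsum, hesum, ← Finset.mul_sum] at key
  -- The Gronwall bound also contains the nonnegative term Δt α₂ times the final squared norm, which
  -- is dropped.
  refine le_trans ?_ key
  have := mul_nonneg (mul_nonneg hdt0.le (S.alpha2_nonneg (n + 1)))
    (hl2 (S.dom (n + 1)) (u (n + 1)))
  linarith
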